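/- Let $k$ be a division ring and $n\ge 0$. Regard $k^n$ as a left and as a right $k$-vector space (scalars acting coordinatewise). A left (right) affine subspace of $k^n$ is a translate of a left (right) vector subspace; it is two-sided if it is both left and right, and purely left if it is left but not right. (The left and right dimensions of a two-sided affine subspace coincide.) Let $f:k^n\to k^n$ be an injective map that sends every left or right affine subspace to a left or right affine subspace. (1) Then $f$ is bijective and preserves dimension: for every left or right affine subspace $A$, $\dim f(A)=\dim A$. Say that a map $h:k^n\to k^n$ has the standard form if $h(x)=\sigma(g(xa)+b)$ for all $x$, where $a\in k$, $b\in k^n$, $\sigma$ is an automorphism of $k$ applied coordinatewise, and $g:k^n\to k^n$ is a left $k$-linear map defined over the centre $Z(k)$, i.e. its matrix in the standard basis has entries in $Z(k)$. Let $P\subset k^n$ be a two-sided affine plane. (2) Suppose $n\ge 3$ and there is a purely left line $L\subset P$ such that $f(L)$ is a left affine subspace. Then $f$ sends every left affine subspace to a left affine subspace of the same dimension, and $f$ has the standard form. (3) Suppose $n\ge 2$ and $f(L)$ is a right affine subspace for every purely left line $L\subset P$. Then $k$ admits an anti-automorphism, and for every anti-automorphism $\varepsilon$ of $k$ the map $\varepsilon\circ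 f$ ($\varepsilon$ applied coordinatewise) sends every left affine subspace to a left affine subspace of the same dimension and has the standard form. -/

import Mathlib

/-- `A ⊆ kⁿ` is a (nonempty) left affine subspace. -/
def IsLeftAffine {k : Type*} [DivisionRing k] {n : ℕ} (A : Set (Fin n → k)) : Prop :=
  A.Nonempty ∧ ∃ S : AffineSubspace k (Fin n → k), (S : Set (Fin n → k)) = A

/-- `A ⊆ kⁿ` is a (nonempty) right affine subspace: here `kⁿ` is a module over the opposite
ring `kᵐᵒᵖ`, acting by right multiplication on each coordinate. -/
def IsRightAffine {k : Type*} [DivisionRing k] {n : ℕ} (A : Set (Fin n → k)) : Prop :=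
  A.Nonempty ∧ ∃ S : AffineSubspace kᵐᵒᵖ (Fin n → k), (S : Set (Fin n → k)) = A

/-- The dimension of a left affine subspace `A`: the left dimension of its direction, the
left span of the differences of points of `A`. -/
noncomputable def leftDim {k : Type*} [DivisionRing k] {n : ℕ} (A : Set (Fin n → k)) : ℕ :=
  Module.finrank k (vectorSpan k A)

/-- The dimension of a right affine subspace `A`. -/
noncomputable def rightDim {k : Type*} [DivisionRing k] {n : ℕ} (A : Set (Fin n → k)) : ℕ :=
  Module.finrank kᵐᵒᵖ (vectorSpan kᵐᵒᵖ A)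

/-- A purely left line: a left affine line that is not a right affine subspace. -/
def IsPurelyLeftLine {k : Type*} [DivisionRing k] {n : ℕ} (L : Set (Fin n → k)) : Prop :=
  IsLeftAffine L ∧ ¬ IsRightAffine L ∧ leftDim L = 1

/-- A two-sided plane: both a left and a right affine subspace, of dimension 2
(the left and right dimensions of a two-sided affine subspace coincide). -/
def IsTwoSidedPlane {k : Type*} [DivisionRing k] {n : ℕ} (P : Set (Fin n → k)) : Prop :=
  IsLeftAffine P ∧ IsRightAffine P ∧ leftDim P = 2

/-- A left linear map `kⁿ → kⁿ` is defined over the centre of `k` if its matrix in the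
standard basis has entries in the centre. -/
def IsDefinedOverCenter {k : Type*} [DivisionRing k] {n : ℕ}
    (g : (Fin n → k) →ₗ[k] (Fin n → k)) : Prop :=
  ∀ i j : Fin n, g (Pi.single i 1) j ∈ Subring.center k

/-- `f(x) = σ(g(xa) + b)`, with `σ` an automorphism of `k` applied coordinatewise and `g` a left
linear map defined over the centre of `k`. -/
def HasStandardForm {k : Type*} [DivisionRing k] {n : ℕ}
    (f : (Fin n → k) → (Fin n → k)) : Prop :=
  ∃ (a : k) (b : Fin n → k) (σ : k ≃+* k) (g : (Fin n → k) →ₗ[k] (Fin n → k)),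
    IsDefinedOverCenter g ∧
      ∀ (x : Fin n → k) (j : Fin n), f x j = σ (g (fun i => x i * a) j + b j)

/-- `f` sends every left affine subspace to a left affine subspace of the same dimension. -/
def PreservesLeftAffine {k : Type*} [DivisionRing k] {n : ℕ}
    (f : (Fin n → k) → (Fin n → k)) : Prop :=
  ∀ A : Set (Fin n → k), IsLeftAffine A → IsLeftAffine (f '' A) ∧ leftDim (f '' A) = leftDim A

/-! The two vector space structures interact because the right span of a left subspace is two-sided,
and a two-sided subspace has equal left and right dimensions (`dimAgree_mulOpposite`). So dimension
is strictly monotone even on inclusions between a left and a right flat. An injective `f` keeps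
strict chains strict, and completing a flat to a chain from a point to the whole space forces its
dimension to be preserved; applied to the whole space this gives surjectivity.

A line of one kind only lies in at most one plane of the other kind, namely its two-sided hull. In
dimension at least three a line lies in several planes, and this uniqueness propagates: one line
with purely left image forces all lines to have left images (`image_line_of_exists`). The
fundamental theorem of affine geometry then makes `f` semiaffine. In dimension two there is no room
for that argument. There only the purely left directions are under control, so the fundamental
theorem is proved for a set `G` of directions (`exists_isSemiaffine`), and noncommuting scalars show
that these directions suffice.

A semiaffine map that also sends right lines to left or right lines is very special: testing it on
the right lines spanned by `e_i + e_j μ` with `μ` not central shows that its matrix is central up to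
one scalar factor (`exists_mul_mem_center`), which is the standard form. In (3), `f` is semiaffine
from the left to the right structure, so its ring isomorphism is an anti-automorphism; composing
with any `ε` returns to the left structure. -/

open Module

/-! ### Flats for two commuting vector space structures -/

section Flats

variable {K K' V : Type*} [DivisionRing K] [DivisionRing K'] [AddCommGroup V]
  [Module K V] [Module K' V]

/-- `A` is a `d`-dimensional affine subspace of the `K`-vector space `V`. -/
def IsFlat (K : Type*) {V : Type*} [DivisionRing K] [AddCommGroup V] [Module K V]
    (d : ℕ) (A : Set V) : Prop :=
  ∃ (p : V) (S : Submodule K V), finrank K S = d ∧ A = {x | x - p ∈ S}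

/-- `A` is a `d`-dimensional affine subspace for one of the two vector space structures. -/
def IsMixedFlat (K K' : Type*) {V : Type*} [DivisionRing K] [DivisionRing K'] [AddCommGroup V]
    [Module K V] [Module K' V] (d : ℕ) (A : Set V) : Prop :=
  IsFlat K d A ∨ IsFlat K' d A

/-- The two dimensions of a subset that is a subspace for both structures coincide. -/
def DimAgree (K K' V : Type*) [DivisionRing K] [DivisionRing K'] [AddCommGroup V]
    [Module K V] [Module K' V] : Prop :=
  ∀ (S : Submodule K V) (S' : Submodule K' V), (S : Set V) = S' → finrank K S = finrank K' S'

theorem DimAgree.symm (h : DimAgree K K' V) : DimAgree K' K V :=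
  fun S S' e => (h S' S e.symm).symm

theorem IsMixedFlat.symm {d : ℕ} {A : Set V} (h : IsMixedFlat K K' d A) : IsMixedFlat K' K d A :=
  Or.symm h

theorem setOf_sub_mem_eq (S : Submodule K V) {p q : V} (h : q - p ∈ S) :
    {x | x - p ∈ S} = {x | x - q ∈ S} := by
  ext x
  have : x - p = (x - q) + (q - p) := by abel
  simp only [Set.mem_ofPred_eq, this, S.add_mem_iff_left h]

theorem IsFlat.exists_direction {d : ℕ} {A : Set V} (h : IsFlat K d A) :
    ∃ S : Submodule K V, finrank K S = d ∧ ∀ q ∈ A, A = {x | x - q ∈ S} := by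
  obtain ⟨p, S, hS, rfl⟩ := h
  exact ⟨S, hS, fun q hq => setOf_sub_mem_eq S hq⟩

theorem IsFlat.nonempty {d : ℕ} {A : Set V} (h : IsFlat K d A) : A.Nonempty := by
  obtain ⟨p, S, hS, rfl⟩ := h
  exact ⟨p, by simp⟩

theorem isFlat_singleton (x : V) : IsFlat K 0 ({x} : Set V) :=
  ⟨x, ⊥, by simp, by ext y; simp [sub_eq_zero]⟩

theorem isFlat_univ : IsFlat K (finrank K V) (Set.univ : Set V) :=
  ⟨0, ⊤, by simp, by ext y; simp⟩

theorem IsFlat.mono [FiniteDimensional K V] {d e : ℕ} {A B : Set V} (hA : IsFlat K d A)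
    (hB : IsFlat K e B) (h : A ⊆ B) : d ≤ e ∧ (d = e → A = B) := by
  obtain ⟨p, hp⟩ := hA.nonempty
  obtain ⟨S, hS, hSA⟩ := hA.exists_direction
  obtain ⟨T, hT, hTB⟩ := hB.exists_direction
  have hpB := h hp
  rw [hSA p hp, hTB p hpB] at h ⊢
  have hST : S ≤ T := by
    intro s hs
    have := @h (s + p) (by simpa using hs)
    simpa using this
  subst hS hT
  refine ⟨Submodule.finrank_mono hST, fun heq => ?_⟩
  rw [Submodule.eq_of_le_of_finrank_eq hST heq]

/-- The affine span of a flat and a further point. -/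
theorem IsFlat.exists_extend [FiniteDimensional K V] {d : ℕ} {A : Set V} (hA : IsFlat K d A)
    {q : V} (hq : q ∉ A) :
    ∃ B : Set V, IsFlat K (d + 1) B ∧ A ⊆ B ∧ q ∈ B ∧
      ∀ (e : ℕ) (C : Set V), IsFlat K e C → A ⊆ C → q ∈ C → B ⊆ C := by
  obtain ⟨p, hp⟩ := hA.nonempty
  obtain ⟨S, hS, hSA⟩ := hA.exists_direction
  rw [hSA p hp] at hq ⊢
  refine ⟨{x | x - p ∈ S ⊔ Submodule.span K {q - p}}, ⟨p, _, ?_, rfl⟩, ?_, ?_, ?_⟩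
  · rw [Submodule.finrank_sup_span_singleton hq, hS]
  · exact fun x hx => Submodule.mem_sup_left hx
  · exact Submodule.mem_sup_right (Submodule.mem_span_singleton_self _)
  · intro e C hC hAC hqC
    obtain ⟨T, hT, hTC⟩ := hC.exists_direction
    have hpC : p ∈ C := hAC (by simp)
    rw [hTC p hpC] at hAC hqC ⊢
    have : S ⊔ Submodule.span K {q - p} ≤ T := by
      refine sup_le (fun s hs => ?_) ?_
      · have := @hAC (s + p) (by simpa using hs)
        simpa using this
      · rw [Submodule.span_singleton_le_iff_mem]
        exact hqC
    exact fun x hx => this hx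

theorem IsFlat.exists_shrink [FiniteDimensional K V] {d : ℕ} {A : Set V}
    (hA : IsFlat K (d + 1) A) : ∃ B : Set V, IsFlat K d B ∧ B ⊆ A ∧ B ≠ A := by
  obtain ⟨p, T, hT, rfl⟩ := hA
  have hne : T ≠ ⊥ := by
    rintro rfl
    simp at hT
  obtain ⟨x, hxT, hx0⟩ := Submodule.exists_mem_ne_zero_of_ne_bot hne
  obtain ⟨C, hC⟩ := Submodule.exists_isCompl (Submodule.span K {x})
  have hxC : x ∉ C ⊓ T := by
    intro h
    have := Submodule.disjoint_def.1 hC.disjoint x (Submodule.mem_span_singleton_self x) h.1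
    exact hx0 this
  have hsup : C ⊓ T ⊔ Submodule.span K {x} = T := by
    have hle : Submodule.span K {x} ≤ T := by
      rwa [Submodule.span_singleton_le_iff_mem]
    rw [inf_comm, inf_sup_assoc_of_le _ hle, sup_comm C, hC.sup_eq_top, inf_top_eq]
  have hfr := Submodule.finrank_sup_span_singleton hxC
  rw [hsup, hT] at hfr
  refine ⟨{y | y - p ∈ C ⊓ T}, ⟨p, _, by omega, rfl⟩, fun y hy => hy.2, fun heq => hxC ?_⟩
  have : x + p ∈ {y | y - p ∈ C ⊓ T} := by
    rw [heq]
    simpa using hxT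
  simpa using this

/-- The span, for the second structure, of a subspace for the first one is two-sided. -/
theorem IsFlat.exists_biflat [SMulCommClass K K' V] [FiniteDimensional K' V]
    (hdim : DimAgree K K' V) {d : ℕ} {A : Set V} (hA : IsFlat K d A) :
    ∃ (e : ℕ) (B : Set V), IsFlat K e B ∧ IsFlat K' e B ∧ A ⊆ B ∧
      ∀ (e' : ℕ) (C : Set V), IsFlat K' e' C → A ⊆ C → B ⊆ C := by
  obtain ⟨p, S, hS, rfl⟩ := hA
  let U' : Submodule K' V := Submodule.span K' (S : Set V)
  let U : Submodule K V :=
    { carrier := U'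
      add_mem' := fun ha hb => U'.add_mem ha hb
      zero_mem' := U'.zero_mem
      smul_mem' := by
        intro c x hx
        refine Submodule.span_induction (p := fun x _ => c • x ∈ U') ?_ ?_ ?_ ?_ hx
        · exact fun y hy => Submodule.subset_span (S.smul_mem c hy)
        · simp
        · intro x y _ _ h1 h2
          rw [smul_add]
          exact U'.add_mem h1 h2
        · intro a y _ h1
          rw [smul_comm]
          exact U'.smul_mem a h1 }
  have hUU : (U : Set V) = U' := rfl
  refine ⟨finrank K' U', {x | x - p ∈ U'}, ⟨p, U, hdim _ _ hUU, rfl⟩, ⟨p, U', rfl, rfl⟩,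
    fun x hx => Submodule.subset_span hx, ?_⟩
  intro e' C hC hAC
  obtain ⟨T, hT, hTC⟩ := hC.exists_direction
  have hpC : p ∈ C := hAC (by simp)
  rw [hTC p hpC] at hAC ⊢
  have : U' ≤ T := by
    refine Submodule.span_le.2 fun s hs => ?_
    have := @hAC (s + p) (by simpa using hs)
    simpa using this
  exact fun x hx => this hx

variable [SMulCommClass K K' V] [FiniteDimensional K V] [FiniteDimensional K' V]

/-- The two-sided hull of `A` lies between `A` and `B`, so each half of the comparison takes place
within one structure. -/
theorem IsFlat.mono' (hdim : DimAgree K K' V) {d e : ℕ} {A B : Set V}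
    (hA : IsFlat K d A) (hB : IsFlat K' e B) (h : A ⊆ B) : d ≤ e ∧ (d = e → A = B) := by
  obtain ⟨m, C, hC, hC', hAC, hmin⟩ := hA.exists_biflat hdim
  have h1 := hA.mono hC hAC
  have h2 := hC'.mono hB (hmin _ _ hB h)
  refine ⟨h1.1.trans h2.1, fun hde => ?_⟩
  rw [h1.2 (by omega), h2.2 (by omega)]

theorem IsMixedFlat.mono (hdim : DimAgree K K' V) {d e : ℕ} {A B : Set V}
    (hA : IsMixedFlat K K' d A) (hB : IsMixedFlat K K' e B) (h : A ⊆ B) :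
    d ≤ e ∧ (d = e → A = B) := by
  have : SMulCommClass K' K V := SMulCommClass.symm _ _ _
  rcases hA with hA | hA <;> rcases hB with hB | hB
  · exact hA.mono hB h
  · exact hA.mono' hdim hB h
  · exact hA.mono' hdim.symm hB h
  · exact hA.mono hB h

theorem IsMixedFlat.lt_of_ssubset (hdim : DimAgree K K' V) {d e : ℕ} {A B : Set V}
    (hA : IsMixedFlat K K' d A) (hB : IsMixedFlat K K' e B) (h : A ⊆ B) (hne : A ≠ B) :
    d < e := by
  have := hA.mono hdim hB h
  exact lt_of_le_of_ne this.1 fun h => hne (this.2 h)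

end Flats

/-! ### Preservation of dimension and surjectivity -/

section Dimension

variable {K L L' V W : Type*} [DivisionRing K] [DivisionRing L] [DivisionRing L']
  [AddCommGroup V] [AddCommGroup W] [Module K V] [Module L W] [Module L' W]
  [FiniteDimensional K V] [FiniteDimensional L W] [FiniteDimensional L' W] [SMulCommClass L L' W]

/-- An injective map that sends flats to flats preserves dimensions, if the dimensions of the
two spaces agree. -/
theorem dim_image_eq (hdim : DimAgree L L' W) (hVW : finrank K V = finrank L W)
    {f : V → W} (hinj : Function.Injective f)
    (hf : ∀ (d : ℕ) (A : Set V), IsFlat K d A → ∃ e, IsMixedFlat L L' e (f '' A))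
    {d e : ℕ} {A : Set V} (hA : IsFlat K d A) (he : IsMixedFlat L L' e (f '' A)) : e = d := by
  have hlt : ∀ {a b : ℕ} {A B : Set V}, IsMixedFlat L L' a (f '' A) →
      IsMixedFlat L L' b (f '' B) → A ⊆ B → A ≠ B → a < b := fun ha hb h hne =>
    ha.lt_of_ssubset hdim hb (Set.image_mono h) fun h' => hne (hinj.image_injective h')
  -- A descending chain below `A` bounds the dimension of the image from below.
  have hlow : ∀ (d e : ℕ) (A : Set V), IsFlat K d A → IsMixedFlat L L' e (f '' A) → d ≤ e := by
    intro d
    induction d with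
    | zero => exact fun _ _ _ _ => Nat.zero_le _
    | succ d ih =>
      intro e A hA he
      obtain ⟨B, hB, hBA, hne⟩ := hA.exists_shrink
      obtain ⟨m, hm⟩ := hf d B hB
      have h1 := ih m B hB hm
      have h2 := hlt hm he hBA hne
      omega
  -- An ascending chain up to the whole space bounds it from above; `c` is the codimension.
  have hup : ∀ (c d e : ℕ) (A : Set V), IsFlat K d A → d + c = finrank K V →
      IsMixedFlat L L' e (f '' A) → e ≤ d := by
    intro c
    induction c with
    | zero =>
      intro d e A _ hd he
      have := (he.mono hdim (Or.inl isFlat_univ) (Set.subset_univ _)).1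
      omega
    | succ c ih =>
      intro d e A hA hd he
      have : A ≠ Set.univ := by
        rintro rfl
        have := ((isFlat_univ (K := K) (V := V)).mono hA subset_rfl).1
        omega
      obtain ⟨q, hq⟩ := (Set.ne_univ_iff_exists_notMem A).1 this
      obtain ⟨B, hB, hAB, hqB, _⟩ := hA.exists_extend hq
      obtain ⟨m, hm⟩ := hf _ B hB
      have h1 := ih (d + 1) m B hB (by omega) hm
      have h2 := hlt he hm hAB fun h => hq (h ▸ hqB)
      omega
  have hle := (hA.mono isFlat_univ (Set.subset_univ _)).1
  exact le_antisymm (hup (finrank K V - d) d e A hA (by omega) he) (hlow d e A hA he)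

theorem surjective_of_image_flat (hdim : DimAgree L L' W) (hVW : finrank K V = finrank L W)
    {f : V → W} (hinj : Function.Injective f)
    (hf : ∀ (d : ℕ) (A : Set V), IsFlat K d A → ∃ e, IsMixedFlat L L' e (f '' A)) :
    Function.Surjective f := by
  obtain ⟨e, he⟩ := hf _ _ (isFlat_univ (K := K) (V := V))
  have := dim_image_eq hdim hVW hinj hf isFlat_univ he
  have h := (he.mono hdim (Or.inl (isFlat_univ (K := L) (V := W))) (Set.subset_univ _)).2
    (by omega)
  rwa [Set.image_univ, Set.range_eq_univ] at h

end Dimension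

/-! ### Incidence of points, lines and planes -/

section Incidence

variable {K V : Type*} [DivisionRing K] [AddCommGroup V] [Module K V] [FiniteDimensional K V]

theorem IsFlat.eq_of_subset_of_mem {d : ℕ} {A B C : Set V} {q : V} (hA : IsFlat K d A)
    (hq : q ∉ A) (hB : IsFlat K (d + 1) B) (hC : IsFlat K (d + 1) C) (hAB : A ⊆ B) (hqB : q ∈ B)
    (hAC : A ⊆ C) (hqC : q ∈ C) : B = C := by
  obtain ⟨D, hD, _, _, hmin⟩ := hA.exists_extend hq
  rw [← (hD.mono hB (hmin _ _ hB hAB hqB)).2 rfl, ← (hD.mono hC (hmin _ _ hC hAC hqC)).2 rfl]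

theorem exists_line {x y : V} (hxy : x ≠ y) : ∃ l : Set V, IsFlat K 1 l ∧ x ∈ l ∧ y ∈ l := by
  obtain ⟨B, hB, hx, hy, _⟩ :=
    (isFlat_singleton (K := K) x).exists_extend (q := y) (by simpa using hxy.symm)
  exact ⟨B, hB, by simpa using hx, hy⟩

theorem IsFlat.line_subset {d : ℕ} {l A : Set V} {x y : V} (hl : IsFlat K 1 l)
    (hA : IsFlat K d A) (hxy : x ≠ y) (hx : x ∈ l) (hy : y ∈ l) (hxA : x ∈ A) (hyA : y ∈ A) :
    l ⊆ A := by
  obtain ⟨B, hB, _, _, hmin⟩ :=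
    (isFlat_singleton (K := K) x).exists_extend (q := y) (by simpa using hxy.symm)
  rw [← (hB.mono hl (hmin _ _ hl (by simpa using hx) hy)).2 rfl]
  exact hmin _ _ hA (by simpa using hxA) hyA

theorem IsFlat.line_unique {l m : Set V} {x y : V} (hl : IsFlat K 1 l)
    (hm : IsFlat K 1 m) (hxy : x ≠ y) (hx : x ∈ l) (hy : y ∈ l) (hxm : x ∈ m) (hym : y ∈ m) :
    l = m :=
  (hl.mono hm (hl.line_subset hm hxy hx hy hxm hym)).2 rfl

theorem IsFlat.exists_ne {l : Set V} (hl : IsFlat K 1 l) (x : V) : ∃ y ∈ l, y ≠ x := by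
  by_contra! h
  have : l ⊆ {x} := fun y hy => by simpa using h y hy
  have := (hl.mono (isFlat_singleton (K := K) x) this).1
  omega

theorem IsFlat.exists_notMem {d : ℕ} {A : Set V} (hA : IsFlat K d A) (hd : d < finrank K V) :
    ∃ x, x ∉ A := by
  by_contra! h
  have := ((isFlat_univ (K := K) (V := V)).mono hA fun x _ => h x).1
  omega

theorem IsFlat.eq_or_inter {l m : Set V} (hl : IsFlat K 1 l) (hm : IsFlat K 1 m) {x : V}
    (hx : x ∈ l) (hxm : x ∈ m) (hne : l ≠ m) : ∀ y ∈ l, y ≠ x → y ∉ m := fun _ hy hyx hym =>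
  hne (hl.line_unique hm hyx.symm hx hy hxm hym)

end Incidence

/-! ### One-sided lines in planes of the other kind -/

section Biflat

variable {L L' W : Type*} [DivisionRing L] [DivisionRing L'] [AddCommGroup W]
  [Module L W] [Module L' W] [FiniteDimensional L W] [FiniteDimensional L' W]
  [SMulCommClass L L' W]

/-- A line for the first structure that is not one for the second lies in at most one plane for
the second structure, which is then two-sided. -/
theorem IsFlat.exists_unique_plane (hdim : DimAgree L L' W) {N : Set W} (hN : IsFlat L 1 N)
    (hN' : ¬ IsFlat L' 1 N) :
    ∃ H : Set W, ∀ B, IsFlat L' 2 B → N ⊆ B → B = H ∧ IsFlat L 2 B := by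
  obtain ⟨e, H, hH, hH', hNH, hmin⟩ := hN.exists_biflat hdim
  refine ⟨H, fun B hB hNB => ?_⟩
  have h1 := hN.mono hH hNH
  have h2 := hH'.mono hB (hmin _ _ hB hNB)
  -- The hull has dimension 1 or 2, and dimension 1 would make `N` itself two-sided.
  have h3 : e ≠ 1 := by
    rintro rfl
    rw [h1.2 rfl] at hN'
    exact hN' hH'
  have h4 : e = 2 := by omega
  subst h4
  have h5 := h2.2 rfl
  exact ⟨h5.symm, h5 ▸ hH⟩

/-- The two `L'`-directions span an `L'`-subspace inside the direction of `B`. Its dimension is at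
most 2 by the mixed comparison, and it is not 1 because the lines differ. -/
theorem IsFlat.of_two_lines (hdim : DimAgree L L' W) {B m₁ m₂ : Set W} {q : W}
    (hB : IsFlat L 2 B) (h₁ : IsFlat L' 1 m₁) (h₂ : IsFlat L' 1 m₂) (hne : m₁ ≠ m₂)
    (hq₁ : q ∈ m₁) (hq₂ : q ∈ m₂) (hB₁ : m₁ ⊆ B) (hB₂ : m₂ ⊆ B) : IsFlat L' 2 B := by
  have : SMulCommClass L' L W := SMulCommClass.symm _ _ _
  obtain ⟨T, hT, hTB⟩ := hB.exists_direction
  obtain ⟨S₁, hS₁, hSm₁⟩ := h₁.exists_direction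
  obtain ⟨S₂, hS₂, hSm₂⟩ := h₂.exists_direction
  have hC : IsFlat L' (finrank L' ↥(S₁ ⊔ S₂)) {x | x - q ∈ S₁ ⊔ S₂} := ⟨q, _, rfl, rfl⟩
  have hqB := hB₁ hq₁
  rw [hTB q hqB] at hB₁ hB₂ hB ⊢
  have key : {x | x - q ∈ S₁ ⊔ S₂} ⊆ {x | x - q ∈ T} := by
    intro x hx
    obtain ⟨a, ha, b, hb, hab⟩ := Submodule.mem_sup.1 hx
    have ha' : a + q ∈ {x | x - q ∈ T} := hB₁ (by rw [hSm₁ q hq₁]; simpa using ha)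
    have hb' : b + q ∈ {x | x - q ∈ T} := hB₂ (by rw [hSm₂ q hq₂]; simpa using hb)
    simp only [Set.mem_ofPred_eq, add_sub_cancel_right] at ha' hb'
    show x - q ∈ T
    rw [← hab]
    exact T.add_mem ha' hb'
  have hm₁ : m₁ ⊆ {x | x - q ∈ S₁ ⊔ S₂} := by
    rw [hSm₁ q hq₁]
    exact fun x hx => Submodule.mem_sup_left hx
  have hm₂ : m₂ ⊆ {x | x - q ∈ S₁ ⊔ S₂} := by
    rw [hSm₂ q hq₂]
    exact fun x hx => Submodule.mem_sup_right hx
  have h1 := h₁.mono hC hm₁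
  have h2 := h₂.mono hC hm₂
  have h3 := hC.mono' hdim.symm hB key
  have h4 : finrank L' ↥(S₁ ⊔ S₂) ≠ 1 := fun h => hne ((h1.2 h.symm).trans (h2.2 h.symm).symm)
  have h5 : finrank L' ↥(S₁ ⊔ S₂) = 2 := by omega
  rw [← h3.2 h5, ← h5]
  exact hC

/-- Uniqueness of the hull, pulled back along `f`: this is the rigidity that drives the dichotomy
below. -/
theorem plane_unique {V : Type*} {f : V → W} (hdim : DimAgree L L' W) (hinj : Function.Injective f)
    {l A B : Set V} (hl : IsFlat L 1 (f '' l)) (hl' : ¬ IsFlat L' 1 (f '' l))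
    (hlA : l ⊆ A) (hlB : l ⊆ B) (hA : IsFlat L' 2 (f '' A)) (hB : IsFlat L' 2 (f '' B)) :
    A = B := by
  obtain ⟨H, hH⟩ := hl.exists_unique_plane hdim hl'
  exact hinj.image_injective
    ((hH _ hA (Set.image_mono hlA)).1.trans (hH _ hB (Set.image_mono hlB)).1.symm)

end Biflat

/-! ### Dichotomy in dimension at least three: all line images share one kind -/

section Dichotomy

variable {K L L' V W : Type*} [DivisionRing K] [DivisionRing L] [DivisionRing L']
  [AddCommGroup V] [AddCommGroup W] [Module K V] [Module L W] [Module L' W]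
  [FiniteDimensional L W] [FiniteDimensional L' W] [SMulCommClass L L' W]
  {f : V → W}

/-- If the image of the plane is an `L'`-plane, it is the hull of `f '' l`, hence two-sided. -/
theorem image_plane_isFlat (hdim : DimAgree L L' W)
    (hf : ∀ (d : ℕ) (A : Set V), IsFlat K d A → IsMixedFlat L L' d (f '' A))
    {l A : Set V} (hl : IsFlat L 1 (f '' l)) (hl' : ¬ IsFlat L' 1 (f '' l))
    (hA : IsFlat K 2 A) (h : l ⊆ A) : IsFlat L 2 (f '' A) := by
  obtain ⟨H, hH⟩ := hl.exists_unique_plane hdim hl'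
  exact (hf 2 A hA).elim id fun h' => (hH _ h' (Set.image_mono h)).2

theorem image_line_isFlat (hdim : DimAgree L L' W)
    (hf : ∀ (d : ℕ) (A : Set V), IsFlat K d A → IsMixedFlat L L' d (f '' A))
    {m A : Set V} (hA : IsFlat K 2 A) (hA' : ¬ IsFlat L' 2 (f '' A)) (hm : IsFlat K 1 m)
    (h : m ⊆ A) : IsFlat L 1 (f '' m) := by
  have : SMulCommClass L' L W := SMulCommClass.symm _ _ _
  by_contra hn
  exact hA' (image_plane_isFlat hdim.symm (fun d A h => (hf d A h).symm)
    ((hf 1 m hm).resolve_left hn) hn hA h)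

variable [FiniteDimensional K V]

/-- Otherwise `m` has purely `L'` image, and the plane `A₀` of `l` and `m` has two-sided image. By
uniqueness another plane `A` through `l` has no `L'` image, yet planes through `m` put two `L'`
lines into it, a contradiction. -/
theorem image_line_of_meets (hdim : DimAgree L L' W) (hinj : Function.Injective f)
    (hf : ∀ (d : ℕ) (A : Set V), IsFlat K d A → IsMixedFlat L L' d (f '' A))
    (h3 : 3 ≤ finrank K V) {l m : Set V} {p : V} (hlK : IsFlat K 1 l)
    (hl : IsFlat L 1 (f '' l)) (hl' : ¬ IsFlat L' 1 (f '' l)) (hm : IsFlat K 1 m)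
    (hpl : p ∈ l) (hpm : p ∈ m) : IsFlat L 1 (f '' m) := by
  have : SMulCommClass L' L W := SMulCommClass.symm _ _ _
  have hf' : ∀ (d : ℕ) (A : Set V), IsFlat K d A → IsMixedFlat L' L d (f '' A) :=
    fun d A h => (hf d A h).symm
  by_contra hn
  have hm' := (hf 1 m hm).resolve_left hn
  have hlm : m ≠ l := by
    rintro rfl
    exact hn hl
  obtain ⟨q, hqm, hqp⟩ := hm.exists_ne p
  have hql : q ∉ l := hm.eq_or_inter hlK hpm hpl hlm q hqm hqp
  obtain ⟨A₀, hA₀, hlA₀, hqA₀, -⟩ := hlK.exists_extend hql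
  have hmA₀ : m ⊆ A₀ := hm.line_subset hA₀ hqp hqm hpm hqA₀ (hlA₀ hpl)
  have hL'A₀ : IsFlat L' 2 (f '' A₀) := image_plane_isFlat hdim.symm hf' hm' hn hA₀ hmA₀
  have hLA₀ : IsFlat L 2 (f '' A₀) := image_plane_isFlat hdim hf hl hl' hA₀ hlA₀
  obtain ⟨r, hr⟩ := hA₀.exists_notMem (by omega)
  obtain ⟨A, hA, hlA, hrA, -⟩ := hlK.exists_extend fun h => hr (hlA₀ h)
  have hL'A : ¬ IsFlat L' 2 (f '' A) := fun h =>
    hr (plane_unique hdim hinj hl hl' hlA hlA₀ h hL'A₀ ▸ hrA)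
  -- The plane `B` of `m` and `s` differs from `A₀`, so its image is not an `L`-plane, and then all
  -- lines in `B` have `L'` images.
  have two : ∀ s ∈ A, s ∉ A₀ → ∀ t : Set V, IsFlat K 1 t → p ∈ t → s ∈ t →
      IsFlat L' 1 (f '' t) := by
    intro s hsA hs t ht hpt hst
    obtain ⟨B, hB, hmB, hsB, -⟩ := hm.exists_extend fun h => hs (hmA₀ h)
    have hLB : ¬ IsFlat L 2 (f '' B) := fun h =>
      hs (plane_unique hdim.symm hinj hm' hn hmB hmA₀ h hLA₀ ▸ hsB)
    have hps : p ≠ s := by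
      rintro rfl
      exact hs (hlA₀ hpl)
    exact image_line_isFlat hdim.symm hf' hB hLB ht (ht.line_subset hB hps hpt hst (hmB hpm) hsB)
  have hpr : p ≠ r := by
    rintro rfl
    exact hr (hlA₀ hpl)
  obtain ⟨u, hu, hup⟩ := hlK.exists_ne p
  obtain ⟨t, ht, hpt, hrt⟩ := exists_line (K := K) hpr
  have htA : t ⊆ A := ht.line_subset hA hpr hpt hrt (hlA hpl) hrA
  have hut : u ∉ t := fun h => hr <| by
    rw [ht.line_unique hlK hup.symm hpt h hpl hu] at hrt
    exact hlA₀ hrt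
  obtain ⟨S, hS, hSA⟩ := hA.exists_direction
  -- Moving `r` parallel to `l` stays in `A` and off `A₀`, and gives a second line through `p`.
  have hs : r + (u - p) ∈ A := by
    have hrS : r - p ∈ S := by
      have := hSA p (hlA hpl) ▸ hrA
      exact this
    have huS : u - p ∈ S := by
      have := hSA p (hlA hpl) ▸ hlA hu
      exact this
    rw [hSA p (hlA hpl)]
    have : r + (u - p) - p = (r - p) + (u - p) := by abel
    show r + (u - p) - p ∈ S
    rw [this]
    exact S.add_mem hrS huS
  obtain ⟨S₀, hS₀, hSA₀⟩ := hA₀.exists_direction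
  have hs₀ : r + (u - p) ∉ A₀ := by
    have huS : u - p ∈ S₀ := by
      have := hSA₀ p (hlA₀ hpl) ▸ hlA₀ hu
      exact this
    intro h
    rw [hSA₀ p (hlA₀ hpl)] at h hr
    apply hr
    have : r - p = (r + (u - p) - p) - (u - p) := by abel
    show r - p ∈ S₀
    rw [this]
    exact S₀.sub_mem h huS
  have hps : p ≠ r + (u - p) := by
    intro h
    rw [← h] at hs₀
    exact hs₀ (hlA₀ hpl)
  obtain ⟨t', ht', hpt', hst'⟩ := exists_line (K := K) hps
  have htA' : t' ⊆ A := ht'.line_subset hA hps hpt' hst' (hlA hpl) hs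
  have htt : t ≠ t' := by
    rintro rfl
    obtain ⟨T, hT, hTt⟩ := ht.exists_direction
    rw [hTt p hpt] at hrt hst' hut
    apply hut
    have : u - p = (r + (u - p) - p) - (r - p) := by abel
    show u - p ∈ T
    rw [this]
    exact T.sub_mem hst' hrt
  exact hL'A (IsFlat.of_two_lines hdim (image_plane_isFlat hdim hf hl hl' hA hlA)
    (two r hrA hr t ht hpt hrt) (two _ hs hs₀ t' ht' hpt' hst')
    (fun h => htt (hinj.image_injective h)) (Set.mem_image_of_mem f hpt)
    (Set.mem_image_of_mem f hpt') (Set.image_mono htA) (Set.image_mono htA'))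

theorem image_plane_of_two_lines (hdim : DimAgree L L' W) (hinj : Function.Injective f)
    {A l : Set V} {q : V} (hA : IsFlat K 2 A) (hLA : IsFlat L 2 (f '' A)) (hl : IsFlat K 1 l)
    (hq : q ∉ l) (hlA : l ⊆ A) (hqA : q ∈ A)
    (h : ∀ p ∈ l, ∀ t : Set V, IsFlat K 1 t → p ∈ t → q ∈ t → IsFlat L' 1 (f '' t)) :
    IsFlat L' 2 (f '' A) := by
  obtain ⟨p, hp⟩ := hl.nonempty
  obtain ⟨p', hp', hpp⟩ := hl.exists_ne p
  have hne : ∀ x ∈ l, x ≠ q := by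
    rintro x hx rfl
    exact hq hx
  obtain ⟨t, ht, hpt, hqt⟩ := exists_line (K := K) (hne p hp)
  obtain ⟨t', ht', hpt', hqt'⟩ := exists_line (K := K) (hne p' hp')
  refine IsFlat.of_two_lines hdim hLA (h p hp t ht hpt hqt) (h p' hp' t' ht' hpt' hqt') ?_
    (Set.mem_image_of_mem f hqt) (Set.mem_image_of_mem f hqt')
    (Set.image_mono (ht.line_subset hA (hne p hp) hpt hqt (hlA hp) hqA))
    (Set.image_mono (ht'.line_subset hA (hne p' hp') hpt' hqt' (hlA hp') hqA))
  intro heq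
  have := hinj.image_injective heq
  subst this
  rw [ht.line_unique hl hpp.symm hpt hpt' hp hp'] at hqt
  exact hq hqt

/-- If the image of one line is an affine subspace for the first structure only, then the images
of all lines are affine subspaces for the first structure. -/
theorem image_line_of_exists (hdim : DimAgree L L' W) (hinj : Function.Injective f)
    (hf : ∀ (d : ℕ) (A : Set V), IsFlat K d A → IsMixedFlat L L' d (f '' A))
    (h3 : 3 ≤ finrank K V) {l m : Set V} (hlK : IsFlat K 1 l)
    (hl : IsFlat L 1 (f '' l)) (hl' : ¬ IsFlat L' 1 (f '' l)) (hm : IsFlat K 1 m) :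
    IsFlat L 1 (f '' m) := by
  have : SMulCommClass L' L W := SMulCommClass.symm _ _ _
  have hf' : ∀ (d : ℕ) (A : Set V), IsFlat K d A → IsMixedFlat L' L d (f '' A) :=
    fun d A h => (hf d A h).symm
  by_contra hn
  have hm' := (hf 1 m hm).resolve_left hn
  have hdisj : ∀ l : Set V, IsFlat K 1 l → IsFlat L 1 (f '' l) → ¬ IsFlat L' 1 (f '' l) →
      ∀ q ∈ m, q ∉ l := fun l hlK hl hl' q hqm hql =>
    hn (image_line_of_meets hdim hinj hf h3 hlK hl hl' hm hql hqm)
  -- Lines joining `l` to `m` meet `m`, so they have `L'` images. Hence the plane of `l` and any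
  -- point of `m` has an `L'` image; by uniqueness these planes coincide, and the common plane
  -- contains `m`.
  have cop : ∀ l : Set V, IsFlat K 1 l → IsFlat L 1 (f '' l) → ¬ IsFlat L' 1 (f '' l) →
      ∃ A, IsFlat K 2 A ∧ l ⊆ A ∧ m ⊆ A ∧ IsFlat L' 2 (f '' A) := by
    intro l hlK hl hl'
    have two : ∀ q ∈ m, ∀ p ∈ l, ∀ t : Set V, IsFlat K 1 t → p ∈ t → q ∈ t →
        IsFlat L' 1 (f '' t) := fun q hq p hp t ht hpt hqt =>
      image_line_of_meets hdim.symm hinj hf' h3 hm hm' hn ht hq hqt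
    obtain ⟨q, hq⟩ := hm.nonempty
    have plane : ∀ x ∈ m, ∃ A, IsFlat K 2 A ∧ l ⊆ A ∧ x ∈ A ∧ IsFlat L' 2 (f '' A) := by
      intro x hx
      have hxl := hdisj l hlK hl hl' x hx
      obtain ⟨A, hA, hlA, hxA, -⟩ := hlK.exists_extend hxl
      exact ⟨A, hA, hlA, hxA, image_plane_of_two_lines hdim hinj hA
        (image_plane_isFlat hdim hf hl hl' hA hlA) hlK hxl hlA hxA (two x hx)⟩
    obtain ⟨A, hA, hlA, hqA, hL'⟩ := plane q hq
    refine ⟨A, hA, hlA, fun x hx => ?_, hL'⟩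
    obtain ⟨B, hB, hlB, hxB, hL'B⟩ := plane x hx
    rw [plane_unique hdim hinj hl hl' hlA hlB hL' hL'B]
    exact hxB
  obtain ⟨A₀, hA₀, hlA₀, hmA₀, hL'A₀⟩ := cop l hlK hl hl'
  obtain ⟨r, hr⟩ := hA₀.exists_notMem (by omega)
  have hrl : r ∉ l := fun h => hr (hlA₀ h)
  obtain ⟨A, hA, hlA, hrA, -⟩ := hlK.exists_extend hrl
  have hL'A : ¬ IsFlat L' 2 (f '' A) := fun h =>
    hr (plane_unique hdim hinj hl hl' hlA hlA₀ h hL'A₀ ▸ hrA)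
  -- The line `t` is also coplanar with `m`. Both this plane and `A₀` contain `m` and `p`, so they
  -- agree, which puts `r` into `A₀`.
  have : ∃ p ∈ l, ∃ t : Set V, IsFlat K 1 t ∧ p ∈ t ∧ r ∈ t ∧ ¬ IsFlat L' 1 (f '' t) := by
    by_contra! h
    exact hL'A (image_plane_of_two_lines hdim hinj hA (image_plane_isFlat hdim hf hl hl' hA hlA)
      hlK hrl hlA hrA h)
  obtain ⟨p, hp, t, ht, hpt, hrt, hL't⟩ := this
  obtain ⟨B, hB, htB, hmB, -⟩ := cop t ht ((hf 1 t ht).resolve_right hL't) hL't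
  have hpm : p ∉ m := fun h => hdisj l hlK hl hl' p h hp
  rw [hm.eq_of_subset_of_mem hpm hA₀ hB hmA₀ (hlA₀ hp) hmB (htB hpt)] at hr
  exact hr (htB hrt)

end Dichotomy

/-! ### Images of one-sided lines -/

section PurelyOneSided

/-- A set containing two points whose image is a line for both structures is a line for every
structure whose lines are sent to lines of one of the two kinds. -/
theorem isFlat_of_image_two_sided {K' L L' V W : Type*} [DivisionRing K']
    [DivisionRing L] [DivisionRing L'] [AddCommGroup V] [AddCommGroup W] [Module K' V]
    [Module L W] [Module L' W] [FiniteDimensional K' V]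
    [FiniteDimensional L W] [FiniteDimensional L' W] {f : V → W} (hinj : Function.Injective f)
    (hf : ∀ A : Set V, IsFlat K' 1 A → IsMixedFlat L L' 1 (f '' A)) {l : Set V} {x y : V}
    (hxy : x ≠ y) (hx : x ∈ l) (hy : y ∈ l) (h : IsFlat L 1 (f '' l))
    (h' : IsFlat L' 1 (f '' l)) : IsFlat K' 1 l := by
  obtain ⟨m, hm, hxm, hym⟩ := exists_line (K := K') hxy
  have key : f '' m = f '' l := by
    have mem : ∀ {z : V} {s : Set V}, z ∈ s → f z ∈ f '' s := Set.mem_image_of_mem f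
    rcases hf m hm with h1 | h1
    · exact h1.line_unique h (hinj.ne hxy) (mem hxm) (mem hym) (mem hx) (mem hy)
    · exact h1.line_unique h' (hinj.ne hxy) (mem hxm) (mem hym) (mem hx) (mem hy)
  rwa [← hinj.image_injective key]

end PurelyOneSided

/-! ### The fundamental theorem of affine geometry for a set of directions -/

section Fundamental

variable {K L V W : Type*} [DivisionRing K] [DivisionRing L]
  [AddCommGroup V] [AddCommGroup W] [Module K V] [Module L W]

theorem exists_smul_sub_of_isFlat {f : V → W} (hinj : Function.Injective f) {x p : V} (hx : x ≠ 0)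
    (h : IsFlat L 1 (f '' {z | z - p ∈ Submodule.span K {x}})) :
    (∀ c : K, ∃ d : L, f (p + c • x) - f p = d • (f (p + x) - f p)) ∧
    ∀ d : L, ∃ c : K, f (p + c • x) - f p = d • (f (p + x) - f p) := by
  obtain ⟨S, hS, hSA⟩ := h.exists_direction
  have hmem : ∀ c : K, p + c • x ∈ {z | z - p ∈ Submodule.span K {x}} := fun c => by
    simpa using Submodule.smul_mem _ c (Submodule.mem_span_singleton_self x)
  have hp : f p ∈ f '' {z | z - p ∈ Submodule.span K {x}} := ⟨p, by simp, rfl⟩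
  have hS' : ∀ c : K, f (p + c • x) - f p ∈ S := fun c => by
    have := hSA _ hp ▸ Set.mem_image_of_mem f (hmem c)
    exact this
  have h1 : f (p + x) - f p ∈ S := by simpa using hS' 1
  have h0 : (⟨f (p + x) - f p, h1⟩ : S) ≠ 0 := by
    intro h
    have h2 : f (p + x) - f p = 0 := congrArg Subtype.val h
    rw [sub_eq_zero] at h2
    have := hinj h2
    simp [hx] at this
  constructor
  · intro c
    obtain ⟨d, hd⟩ := exists_smul_eq_of_finrank_eq_one hS h0 ⟨_, hS' c⟩
    exact ⟨d, (congrArg Subtype.val hd).symm⟩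
  · intro d
    have hd : f p + d • (f (p + x) - f p) ∈ f '' {z | z - p ∈ Submodule.span K {x}} := by
      rw [hSA _ hp]
      simpa using S.smul_mem d h1
    obtain ⟨z, hz, hfz⟩ := hd
    obtain ⟨c, hc⟩ := Submodule.mem_span_singleton.1 hz
    refine ⟨c, ?_⟩
    rw [hc, add_sub_cancel, hfz, add_sub_cancel_left]

variable [FiniteDimensional L W] {f : V → W} {G : Set V}

/-- The images of two parallel lines are coplanar and, by injectivity, disjoint; hence they are
parallel. -/
theorem parallel_image (hinj : Function.Injective f) (hG : ∀ x ∈ G, x ≠ 0)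
    (hline : ∀ x ∈ G, ∀ p, IsFlat L 1 (f '' {z | z - p ∈ Submodule.span K {x}}))
    (hplane : ∀ x ∈ G, ∀ y ∈ G, y ∉ Submodule.span K {x} → ∀ p, ∃ B, IsFlat L 2 B ∧
      f '' {z | z - p ∈ Submodule.span K {x, y}} ⊆ B) {x y : V} (hx : x ∈ G) (hy : y ∈ G)
    (hxy : y ∉ Submodule.span K {x}) (p : V) :
    ∃ d : L, f (p + y + x) - f (p + y) = d • (f (p + x) - f p) := by
  obtain ⟨B, hB, hfB⟩ := hplane x hx y hy hxy p
  obtain ⟨T, hT, hTB⟩ := hB.exists_direction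
  have hxs : x ∈ Submodule.span K {x, y} := Submodule.subset_span (by simp)
  have hys : y ∈ Submodule.span K {x, y} := Submodule.subset_span (by simp)
  have hpB : f p ∈ B := hfB ⟨p, by simp, rfl⟩
  have hxB : f (p + x) ∈ B := hfB ⟨p + x, by simpa using hxs, rfl⟩
  have hyB : f (p + y) ∈ B := hfB ⟨p + y, by simpa using hys, rfl⟩
  have hxyB : f (p + y + x) ∈ B :=
    hfB ⟨p + y + x, by simpa [add_assoc] using Submodule.add_mem _ hys hxs, rfl⟩
  have hu : f (p + x) - f p ∈ T := by rw [hTB _ hpB] at hxB; exact hxB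
  have hv : f (p + y) - f p ∈ T := by rw [hTB _ hpB] at hyB; exact hyB
  have hw : f (p + y + x) - f (p + y) ∈ T := by rw [hTB _ hyB] at hxyB; exact hxyB
  obtain ⟨-, hl1⟩ := exists_smul_sub_of_isFlat hinj (hG x hx) (hline x hx p)
  obtain ⟨-, hl2⟩ := exists_smul_sub_of_isFlat hinj (hG x hx) (hline x hx (p + y))
  set u := f (p + x) - f p with hu_def
  set v := f (p + y) - f p with hv_def
  set w := f (p + y + x) - f (p + y) with hw_def
  have hu0 : u ≠ 0 := by
    rw [hu_def, sub_ne_zero]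
    exact hinj.ne (by simpa using hG x hx)
  have hvu : v ∉ Submodule.span L {u} := by
    intro h
    obtain ⟨d, hd⟩ := Submodule.mem_span_singleton.1 h
    obtain ⟨c, hc⟩ := hl1 d
    rw [hd, hv_def, sub_left_inj] at hc
    have := hinj hc
    rw [add_right_inj] at this
    exact hxy (Submodule.mem_span_singleton.2 ⟨c, this⟩)
  have hfd : FiniteDimensional L T := FiniteDimensional.of_finrank_pos (by omega)
  have hspan : Submodule.span L {u} ⊔ Submodule.span L {v} = T := by
    have hle : Submodule.span L {u} ⊔ Submodule.span L {v} ≤ T := by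
      rw [sup_le_iff, Submodule.span_singleton_le_iff_mem, Submodule.span_singleton_le_iff_mem]
      exact ⟨hu, hv⟩
    refine Submodule.eq_of_le_of_finrank_eq hle ?_
    rw [Submodule.finrank_sup_span_singleton hvu, finrank_span_singleton hu0, hT]
  rw [← hspan] at hw
  obtain ⟨a', ha', b', hb', hab⟩ := Submodule.mem_sup.1 hw
  obtain ⟨a, rfl⟩ := Submodule.mem_span_singleton.1 ha'
  obtain ⟨b, rfl⟩ := Submodule.mem_span_singleton.1 hb'
  by_cases hb : b = 0
  · exact ⟨a, by rw [← hab, hb]; simp⟩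
  exfalso
  -- With `w = a u + b v` and `b ≠ 0`, these multiples give the intersection point: `v - b⁻¹ w =
  -- -(b⁻¹ a) u`.
  obtain ⟨c, hc⟩ := hl2 (-b⁻¹)
  obtain ⟨c', hc'⟩ := hl1 (-(b⁻¹ * a))
  have : f (p + y + c • x) = f (p + c' • x) := by
    rw [sub_eq_iff_eq_add] at hc hc'
    rw [hc, hc', ← hab, smul_add, smul_smul, smul_smul]
    have : -b⁻¹ * b = -1 := by rw [neg_mul, inv_mul_cancel₀ hb]
    rw [this, neg_mul, hv_def, neg_smul, neg_smul, one_smul]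
    abel
  have := hinj this
  rw [add_assoc, add_right_inj] at this
  refine hxy (Submodule.mem_span_singleton.2 ⟨c' - c, ?_⟩)
  rw [sub_smul, ← this]
  abel

/-- The fourth vertex is reached along both pairs of parallel sides. Comparing the two expressions,
independence of the image directions forces both factors to be 1. -/
theorem parallelogram_image (hinj : Function.Injective f) (hG : ∀ x ∈ G, x ≠ 0)
    (hline : ∀ x ∈ G, ∀ p, IsFlat L 1 (f '' {z | z - p ∈ Submodule.span K {x}}))
    (hplane : ∀ x ∈ G, ∀ y ∈ G, y ∉ Submodule.span K {x} → ∀ p, ∃ B, IsFlat L 2 B ∧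
      f '' {z | z - p ∈ Submodule.span K {x, y}} ⊆ B) {x y : V} (hx : x ∈ G) (hy : y ∈ G)
    (hxy : y ∉ Submodule.span K {x}) (p : V) :
    f (p + x + y) - f (p + x) = f (p + y) - f p := by
  have hyx : x ∉ Submodule.span K {y} := by
    intro h
    obtain ⟨c, hc⟩ := Submodule.mem_span_singleton.1 h
    have hc0 : c ≠ 0 := by
      rintro rfl
      exact hG x hx (by simpa using hc.symm)
    refine hxy (Submodule.mem_span_singleton.2 ⟨c⁻¹, ?_⟩)
    rw [← hc, smul_smul, inv_mul_cancel₀ hc0, one_smul]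
  obtain ⟨a, ha⟩ := parallel_image hinj hG hline hplane hx hy hxy p
  obtain ⟨b, hb⟩ := parallel_image hinj hG hline hplane hy hx hyx p
  obtain ⟨-, hl⟩ := exists_smul_sub_of_isFlat hinj (hG x hx) (hline x hx p)
  rw [add_right_comm p y x, sub_eq_iff_eq_add] at ha
  rw [sub_eq_iff_eq_add] at hb
  have h1 : (b - 1) • (f (p + y) - f p) = (a - 1) • (f (p + x) - f p) := by
    have h2 := ha.symm.trans hb
    rw [sub_smul, sub_smul, one_smul, one_smul, sub_eq_sub_iff_add_eq_add]
    rw [← sub_eq_zero] at h2 ⊢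
    rw [← neg_eq_zero, ← h2]
    abel
  by_cases h : b - 1 = 0
  · rw [sub_eq_zero] at h
    rw [hb, h, one_smul]
    abel
  · exfalso
    obtain ⟨c, hc⟩ := hl ((b - 1)⁻¹ * (a - 1))
    rw [mul_smul, ← h1, smul_smul, inv_mul_cancel₀ h, one_smul, sub_left_inj] at hc
    have := hinj hc
    rw [add_right_inj] at this
    exact hxy (Submodule.mem_span_singleton.2 ⟨c, this⟩)

/-- For fixed `y ∈ G` the translations `d` leaving the increment along `y` unchanged form a
subgroup, and `hgen` says that directions independent of `y` generate everything. A second induction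
extends this to all `y`. -/
theorem map_add_of_parallelogram (hpar : ∀ x ∈ G, ∀ y ∈ G, x ∉ Submodule.span K {y} → ∀ p,
      f (p + x + y) - f (p + x) = f (p + y) - f p)
    (hne : G.Nonempty)
    (hgen : ∀ y ∈ G, AddSubgroup.closure (G \ Submodule.span K {y}) = ⊤) (p d y : V) :
    f (p + d + y) - f (p + d) = f (p + y) - f p := by
  have hG : AddSubgroup.closure G = ⊤ := by
    obtain ⟨y, hy⟩ := hne
    rw [eq_top_iff, ← hgen y hy]
    exact AddSubgroup.closure_mono Set.sdiff_subset
  have step : ∀ y ∈ G, ∀ d p : V, f (p + d + y) - f (p + d) = f (p + y) - f p := by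
    intro y hy d
    have hd : d ∈ AddSubgroup.closure (G \ Submodule.span K {y}) := by
      rw [hgen y hy]
      trivial
    induction hd using AddSubgroup.closure_induction with
    | mem x hx => exact hpar x hx.1 y hy hx.2
    | zero => simp
    | add a b _ _ iha ihb =>
      intro p
      rw [← add_assoc, ihb, iha]
    | neg a _ iha =>
      intro p
      have := iha (p + -a)
      rw [neg_add_cancel_right] at this
      exact this.symm
  have hy : y ∈ AddSubgroup.closure G := by
    rw [hG]
    trivial
  induction hy using AddSubgroup.closure_induction generalizing p with
  | mem x hx => exact step x hx d p
  | zero => simp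
  | add a b _ _ iha ihb =>
    have h1 := iha p
    have h2 := ihb (p + a)
    rw [add_right_comm p a d] at h2
    rw [← add_assoc, ← add_assoc, ← sub_add_sub_cancel _ (f (p + d + a)), h1, h2]
    abel
  | neg a _ iha =>
    have := iha (p + -a)
    rw [add_right_comm p (-a) d, neg_add_cancel_right, neg_add_cancel_right] at this
    rw [← neg_sub, this, neg_sub]

/-- `f` is a translation after an additive map that is semilinear with respect to `σ`. -/
def IsSemiaffine (σ : K ≃+* L) (f : V → W) : Prop :=
  (∀ x y, f (x + y) - f 0 = (f x - f 0) + (f y - f 0)) ∧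
    ∀ (c : K) (x : V), f (c • x) - f 0 = σ c • (f x - f 0)

/-- The fundamental theorem of affine geometry, for maps that are known to send lines to lines
for the directions in a set `G` only. -/
theorem exists_isSemiaffine (hinj : Function.Injective f) (hG : ∀ x ∈ G, x ≠ 0)
    (hline : ∀ x ∈ G, ∀ p, IsFlat L 1 (f '' {z | z - p ∈ Submodule.span K {x}}))
    (hplane : ∀ x ∈ G, ∀ y ∈ G, y ∉ Submodule.span K {x} → ∀ p, ∃ B, IsFlat L 2 B ∧
      f '' {z | z - p ∈ Submodule.span K {x, y}} ⊆ B) (hne : G.Nonempty)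
    (hgen : ∀ y ∈ G, AddSubgroup.closure (G \ Submodule.span K {y}) = ⊤)
    (hconn : ∀ R : V → V → Prop, Equivalence R →
      (∀ x ∈ G, ∀ y ∈ G, y ∉ Submodule.span K {x} → x + y ∈ G → R x y) →
      ∀ x ∈ G, ∀ y ∈ G, R x y) :
    ∃ σ : K ≃+* L, IsSemiaffine σ f := by
  have htr := map_add_of_parallelogram (f := f) (K := K) (G := G)
    (fun x hx y hy hxy p => by
      have := parallelogram_image hinj hG hline hplane hy hx hxy p
      rw [add_right_comm p y x] at this
      rw [← sub_eq_zero] at this ⊢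
      rw [← this]
      abel) hne hgen
  have hGtop : AddSubgroup.closure G = ⊤ := by
    obtain ⟨y, hy⟩ := hne
    rw [eq_top_iff, ← hgen y hy]
    exact AddSubgroup.closure_mono Set.sdiff_subset
  set g : V → W := fun x => f x - f 0 with hg
  have hadd : ∀ x y, g (x + y) = g x + g y := by
    intro x y
    have := htr 0 x y
    simp only [zero_add] at this
    simp only [hg, ← this]
    abel
  have hg0 : g 0 = 0 := by simp [hg]
  have hginj : Function.Injective g := fun x y h => hinj (by simpa [hg] using h)
  have hlin : ∀ x ∈ G, (∀ c : K, ∃ d : L, g (c • x) = d • g x) ∧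
      ∀ d : L, ∃ c : K, g (c • x) = d • g x := by
    intro x hx
    have := exists_smul_sub_of_isFlat hinj (hG x hx) (hline x hx 0)
    simpa only [zero_add] using this
  have hgne : ∀ x ∈ G, g x ≠ 0 := by
    intro x hx h
    exact hG x hx (hginj (h.trans hg0.symm))
  obtain ⟨x₀, hx₀⟩ := hne
  choose σ hσ using (hlin x₀ hx₀).1
  -- Each direction has its own map of scalars. Independent `x`, `y` with `x + y ∈ G` share theirs,
  -- by expanding `g (c • (x + y))` in two ways; `hconn` spreads this over `G`.
  have hσG : ∀ x ∈ G, ∀ (c : K) (d : L), g (c • x₀) = d • g x₀ ↔ g (c • x) = d • g x := by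
    intro x hx
    refine hconn (fun x y : V => ∀ (c : K) (d : L), g (c • x) = d • g x ↔ g (c • y) = d • g y)
      ⟨fun _ _ _ => Iff.rfl, fun h c d => (h c d).symm, fun h h' c d => (h c d).trans (h' c d)⟩
      ?_ x₀ hx₀ x hx
    intro x hx y hy hxy hxyG c d
    obtain ⟨a, ha⟩ := (hlin x hx).1 c
    obtain ⟨b, hb⟩ := (hlin y hy).1 c
    obtain ⟨e, he⟩ := (hlin _ hxyG).1 c
    rw [smul_add, hadd, hadd, ha, hb] at he
    have h1 : (b - e) • g y = (e - a) • g x := by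
      rw [sub_smul, sub_smul, sub_eq_sub_iff_add_eq_add, add_comm, he, smul_add]
    have hbe : b = e := by
      by_contra hbe
      obtain ⟨c', hc'⟩ := (hlin x hx).2 ((b - e)⁻¹ * (e - a))
      rw [mul_smul, ← h1, smul_smul, inv_mul_cancel₀ (sub_ne_zero.2 hbe), one_smul] at hc'
      exact hxy (Submodule.mem_span_singleton.2 ⟨c', hginj hc'⟩)
    have hae : e = a := by
      rw [hbe, sub_self, zero_smul] at h1
      exact sub_eq_zero.1 ((smul_eq_zero.1 h1.symm).resolve_right (hgne x hx))
    subst hbe hae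
    rw [ha, hb]
    exact ⟨fun h => by rw [smul_left_injective L (hgne x hx) h],
      fun h => by rw [smul_left_injective L (hgne y hy) h]⟩
  have hσV : ∀ c x, g (c • x) = σ c • g x := by
    intro c x
    have hx : x ∈ AddSubgroup.closure G := by
      rw [hGtop]
      trivial
    induction hx using AddSubgroup.closure_induction with
    | mem x hx => exact (hσG x hx c (σ c)).1 (hσ c)
    | zero => simp [hg0]
    | add a b _ _ iha ihb => rw [smul_add, hadd, hadd, iha, ihb, smul_add]
    | neg a _ iha =>
      have hneg : ∀ z, g (-z) = -g z := fun z => by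
        have := hadd z (-z)
        rw [add_neg_cancel, hg0] at this
        exact (neg_eq_of_add_eq_zero_right this.symm).symm
      rw [smul_neg, hneg, hneg, iha, smul_neg]
  have huniq : ∀ {a b : L}, a • g x₀ = b • g x₀ → a = b := fun h =>
    smul_left_injective L (hgne x₀ hx₀) h
  let φ : K →+* L :=
    { toFun := σ
      map_one' := huniq (by rw [← hσV, one_smul, one_smul])
      map_zero' := huniq (by rw [← hσV, zero_smul, zero_smul, hg0])
      map_add' := fun a b => huniq (by rw [← hσV, add_smul, hadd, hσV, hσV, add_smul])
      map_mul' := fun a b => huniq (by rw [← hσV, mul_smul, hσV, hσV, mul_smul]) }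
  refine ⟨RingEquiv.ofBijective φ ⟨φ.injective, fun d => ?_⟩, hadd, hσV⟩
  obtain ⟨c, hc⟩ := (hlin x₀ hx₀).2 d
  exact ⟨c, huniq ((hσV c x₀).symm.trans hc)⟩

/-- Nonzero vectors satisfy the hypotheses on the set of directions in dimension at least two. -/
theorem exists_isSemiaffine_of_lines [FiniteDimensional K V]
    (h2 : 2 ≤ finrank K V) (hinj : Function.Injective f)
    (hline : ∀ A : Set V, IsFlat K 1 A → IsFlat L 1 (f '' A))
    (hplane : ∀ A : Set V, IsFlat K 2 A → IsFlat L 2 (f '' A)) :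
    ∃ σ : K ≃+* L, IsSemiaffine σ f := by
  have hex : ∀ x : V, ∃ y, y ∉ Submodule.span K {x} := by
    intro x
    by_contra! h
    have htop : Submodule.span K {x} = ⊤ := Submodule.eq_top_iff'.2 h
    have := finrank_span_le_card (R := K) ({x} : Set V)
    rw [htop, finrank_top] at this
    simp at this
    omega
  have hex0 : ∀ {x y : V}, y ∉ Submodule.span K {x} → y ≠ 0 := by
    rintro x y h rfl
    simp at h
  refine exists_isSemiaffine (G := {x : V | x ≠ 0}) hinj (fun x hx => hx)
    (fun x hx p => hline _ ⟨p, _, finrank_span_singleton hx, rfl⟩) ?_ ?_ ?_ ?_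
  · intro x hx y hy hxy p
    refine ⟨_, hplane {z | z - p ∈ Submodule.span K {x, y}} ⟨p, _, ?_, rfl⟩, subset_rfl⟩
    rw [Submodule.span_insert, Submodule.finrank_sup_span_singleton hxy,
      finrank_span_singleton hx]
  · obtain ⟨y, hy⟩ := hex 0
    exact ⟨y, hex0 hy⟩
  · intro y hy
    rw [eq_top_iff]
    intro v _
    have hmem : ∀ w, w ∉ Submodule.span K {y} →
        w ∈ AddSubgroup.closure ({x : V | x ≠ 0} \ Submodule.span K {y}) := fun w hw =>
      AddSubgroup.subset_closure ⟨hex0 hw, hw⟩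
    -- A vector on the forbidden line is a difference of two vectors off it.
    by_cases hv : v ∈ Submodule.span K {y}
    · obtain ⟨z, hz⟩ := hex y
      rw [← add_sub_cancel_right v z]
      exact sub_mem (hmem _ fun h => hz (((Submodule.span K {y}).add_mem_iff_right hv).1 h))
        (hmem z hz)
    · exact hmem v hv
  · intro R hR h x hx y hy
    have hstep : ∀ x y : V, x ≠ 0 → y ∉ Submodule.span K {x} → R x y := by
      intro x y hx hxy
      refine h x hx y (hex0 hxy) hxy fun h0 => hxy ?_
      rw [eq_neg_of_add_eq_zero_right h0]
      exact neg_mem (Submodule.mem_span_singleton_self x)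
    -- Proportional vectors are linked through a third, independent one.
    by_cases hxy : y ∈ Submodule.span K {x}
    · obtain ⟨z, hz⟩ := hex x
      refine hR.trans (hstep x z hx hz) (hR.symm (hstep y z hy fun hzy => hz ?_))
      exact (Submodule.span_singleton_le_iff_mem _ _).2 hxy hzy
    · exact hstep x y hx hxy

end Fundamental

/-! ### Images of flats under semiaffine maps, and composition -/

section SemiaffineImage

variable {K K' L L' V W X : Type*} [DivisionRing K] [DivisionRing K'] [DivisionRing L]
  [DivisionRing L'] [AddCommGroup V] [AddCommGroup W] [AddCommGroup X]
  [Module K V] [Module L W] [Module K' X]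

theorem IsSemiaffine.exists_isFlat_image {σ : K ≃+* L} {f : V → W} (hσ : IsSemiaffine σ f) {d : ℕ}
    {A : Set V} (hA : IsFlat K d A) : ∃ e, IsFlat L e (f '' A) := by
  obtain ⟨p, S, hS, rfl⟩ := hA
  obtain ⟨hadd, hsmul⟩ := hσ
  let T : Submodule L W :=
    { carrier := {w | ∃ s ∈ S, f s - f 0 = w}
      add_mem' := by
        rintro _ _ ⟨s, hs, rfl⟩ ⟨t, ht, rfl⟩
        exact ⟨s + t, S.add_mem hs ht, hadd s t⟩
      zero_mem' := ⟨0, S.zero_mem, sub_self _⟩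
      smul_mem' := by
        rintro c _ ⟨s, hs, rfl⟩
        refine ⟨σ.symm c • s, S.smul_mem _ hs, ?_⟩
        rw [hsmul, RingEquiv.apply_symm_apply] }
  refine ⟨finrank L T, f p, T, rfl, ?_⟩
  have hsub : ∀ x, f x - f p = f (x - p) - f 0 := by
    intro x
    have := hadd (x - p) p
    rw [sub_add_cancel] at this
    rw [← sub_sub_sub_cancel_right _ _ (f 0), this, add_sub_cancel_right]
  ext w
  constructor
  · rintro ⟨x, hx, rfl⟩
    exact ⟨x - p, hx, (hsub x).symm⟩
  · rintro ⟨s, hs, hsw⟩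
    refine ⟨s + p, by simpa using hs, ?_⟩
    have := hsub (s + p)
    rw [add_sub_cancel_right, hsw, sub_left_inj] at this
    exact this

theorem IsSemiaffine.comp {σ : K ≃+* L} {τ : L ≃+* K'} {f : V → W} {g : W → X}
    (hg : IsSemiaffine τ g) (hf : IsSemiaffine σ f) (hg0 : g 0 = 0) :
    IsSemiaffine (σ.trans τ) (g ∘ f) := by
  have hadd : ∀ x y, g (x + y) = g x + g y := by simpa [hg0] using hg.1
  have hsub : ∀ x y, g (x - y) = g x - g y := fun x y => by
    rw [eq_sub_iff_add_eq, ← hadd, sub_add_cancel]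
  have hsmul : ∀ (c : L) x, g (c • x) = τ c • g x := by simpa [hg0] using hg.2
  constructor
  · intro x y
    simp only [Function.comp_apply, ← hsub, ← hadd, hf.1]
  · intro c x
    simp only [Function.comp_apply, ← hsub, hf.2, hsmul, RingEquiv.trans_apply]

end SemiaffineImage

/-! ### From lines to planes, and semiaffinity in dimension at least three -/

section PlanesOfLines

variable {K L L' V W : Type*} [DivisionRing K] [DivisionRing L] [DivisionRing L']
  [AddCommGroup V] [AddCommGroup W] [Module K V] [Module L W] [Module L' W]
  [FiniteDimensional K V] [FiniteDimensional L W] [FiniteDimensional L' W] [SMulCommClass L L' W]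
  {f : V → W}

/-- An `L'`-plane image contains two intersecting `L`-lines, so it is also an `L`-plane. -/
theorem image_plane_of_lines (hdim : DimAgree L L' W) (hinj : Function.Injective f)
    (hf : ∀ (d : ℕ) (A : Set V), IsFlat K d A → IsMixedFlat L L' d (f '' A))
    (hline : ∀ A : Set V, IsFlat K 1 A → IsFlat L 1 (f '' A)) {A : Set V} (hA : IsFlat K 2 A) :
    IsFlat L 2 (f '' A) := by
  have : SMulCommClass L' L W := SMulCommClass.symm _ _ _
  rcases hf 2 A hA with h | h
  · exact h
  · obtain ⟨l, hl, hlA, hne⟩ := hA.exists_shrink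
    obtain ⟨q, hqA, hql⟩ := Set.exists_of_ssubset (hlA.ssubset_of_ne hne)
    exact image_plane_of_two_lines hdim.symm hinj hA h hl hql hlA hqA
      fun p _ t ht _ _ => hline t ht

/-- If some line is sent to a subspace for the first structure only, in dimension at least three,
then the map is semiaffine with respect to the first structure. -/
theorem exists_isSemiaffine_of_exists (hdim : DimAgree L L' W) (hinj : Function.Injective f)
    (hf : ∀ (d : ℕ) (A : Set V), IsFlat K d A → IsMixedFlat L L' d (f '' A))
    (h3 : 3 ≤ finrank K V) {l : Set V} (hlK : IsFlat K 1 l) (hl : IsFlat L 1 (f '' l))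
    (hl' : ¬ IsFlat L' 1 (f '' l)) : ∃ σ : K ≃+* L, IsSemiaffine σ f := by
  have hline : ∀ A : Set V, IsFlat K 1 A → IsFlat L 1 (f '' A) := fun A hA =>
    image_line_of_exists hdim hinj hf h3 hlK hl hl' hA
  exact exists_isSemiaffine_of_lines (by omega) hinj hline
    fun A hA => image_plane_of_lines hdim hinj hf hline hA

end PlanesOfLines

/-! ### Left and right dimensions agree in coordinate space -/

section Coordinates

variable {k : Type*} [DivisionRing k]

/-- Taking the underlying element, as a right linear map. -/
def unopRightLinearEquiv (k : Type*) [DivisionRing k] : kᵐᵒᵖ ≃ₗ[kᵐᵒᵖ] k :=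
  { MulOpposite.opAddEquiv.symm with
    map_smul' := fun _ _ => rfl }

instance finiteDimensional_mulOpposite : FiniteDimensional kᵐᵒᵖ k :=
  (unopRightLinearEquiv k).finiteDimensional

theorem finrank_mulOpposite : finrank kᵐᵒᵖ k = 1 := by
  rw [← (unopRightLinearEquiv k).finrank_eq, finrank_self]

theorem finrank_mulOpposite_fun (n : ℕ) : finrank kᵐᵒᵖ (Fin n → k) = n := by
  rw [finrank_pi_fintype]
  simp [finrank_mulOpposite]

/-- The restriction of a subspace of `kⁿ` to a suitable set of coordinates is a bijection. -/
theorem exists_bijective_restrict {n : ℕ} (S : Submodule k (Fin n → k)) :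
    ∃ J : Finset (Fin n), (∀ v ∈ S, (∀ i, i ∉ J → v i = 0) → v = 0) ∧
      ∀ w : {i // i ∉ J} → k, ∃ v ∈ S, ∀ i : {i // i ∉ J}, v i = w i := by
  classical
  -- `J` is maximal such that no nonzero vector of `S` is supported on it. For `i ∉ J`, maximality
  -- yields a vector supported on `J ∪ {i}`, which can be scaled to have entry 1 at `i`.
  obtain ⟨J, hJ, hmax⟩ := (Set.toFinite
    {J : Finset (Fin n) | ∀ v ∈ S, (∀ i, i ∉ J → v i = 0) → v = 0}).exists_maximal
    ⟨∅, fun v _ h => funext fun i => h i (Finset.notMem_empty i)⟩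
  refine ⟨J, hJ, fun w => ?_⟩
  have hex : ∀ i : {i // i ∉ J}, ∃ v ∈ S, ∀ j : {i // i ∉ J}, v j = if j = i then 1 else 0 := by
    rintro ⟨i, hi⟩
    have hJi : insert i J ∉ {J : Finset (Fin n) | ∀ v ∈ S, (∀ i, i ∉ J → v i = 0) → v = 0} :=
      fun h => hi (hmax h (Finset.subset_insert i J) (Finset.mem_insert_self i J))
    have hJi' : ∃ v ∈ S, (∀ j, j ∉ insert i J → v j = 0) ∧ v ≠ 0 := by
      by_contra! h
      exact hJi h
    obtain ⟨v, hv, hv0, hvne⟩ := hJi'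
    have hvi : v i ≠ 0 := by
      intro h
      refine hvne (hJ v hv fun j hj => ?_)
      by_cases hji : j = i
      · rw [hji, h]
      · exact hv0 j (by simp [hji, hj])
    refine ⟨(v i)⁻¹ • v, S.smul_mem _ hv, ?_⟩
    rintro ⟨j, hj⟩
    by_cases hji : j = i
    · subst hji
      simp [hvi]
    · simp [hji, hv0 j (by simp [hji, hj])]
  choose v hv hvi using hex
  refine ⟨∑ i, w i • v i, S.sum_mem fun i _ => S.smul_mem _ (hv i), fun j => ?_⟩
  simp [Finset.sum_apply, hvi]

theorem finrank_eq_of_bijective_restrict {K : Type*} [DivisionRing K] [Module K k]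
    [FiniteDimensional K k] (hK : finrank K k = 1) {n : ℕ} (S : Submodule K (Fin n → k))
    (J : Finset (Fin n)) (h₁ : ∀ v ∈ S, (∀ i, i ∉ J → v i = 0) → v = 0)
    (h₂ : ∀ w : {i // i ∉ J} → k, ∃ v ∈ S, ∀ i : {i // i ∉ J}, v i = w i) :
    finrank K S = Fintype.card {i // i ∉ J} := by
  let r : S →ₗ[K] ({i // i ∉ J} → k) :=
    (LinearMap.funLeft K k (Subtype.val : {i // i ∉ J} → Fin n)).comp S.subtype
  have hr : Function.Bijective r := by
    constructor
    · rw [injective_iff_map_eq_zero]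
      rintro ⟨v, hv⟩ h
      refine Subtype.ext (h₁ v hv fun i hi => ?_)
      exact congrFun h ⟨i, hi⟩
    · intro w
      obtain ⟨v, hv, hvw⟩ := h₂ w
      exact ⟨⟨v, hv⟩, funext hvw⟩
  rw [(LinearEquiv.ofBijective r hr).finrank_eq, finrank_pi_fintype]
  simp [hK]

/-- The conditions on `J` mention only the underlying set of the subspace, so the same `J` computes
both dimensions. -/
theorem dimAgree_mulOpposite (n : ℕ) : DimAgree k kᵐᵒᵖ (Fin n → k) := by
  intro S S' h
  obtain ⟨J, h₁, h₂⟩ := exists_bijective_restrict S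
  have hmem : ∀ v, v ∈ S ↔ v ∈ S' := fun v => Set.ext_iff.1 h v
  rw [finrank_eq_of_bijective_restrict (finrank_self k) S J h₁ h₂,
    finrank_eq_of_bijective_restrict finrank_mulOpposite S' J]
  · simpa only [← hmem] using h₁
  · simpa only [← hmem] using h₂

end Coordinates

/-! ### Comparison with `AffineSubspace` -/

section AffineSubspaces

variable {K V : Type*} [DivisionRing K] [AddCommGroup V] [Module K V]

theorem IsFlat.exists_affineSubspace {d : ℕ} {A : Set V} (h : IsFlat K d A) :
    A.Nonempty ∧ ∃ S : AffineSubspace K V, (S : Set V) = A := by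
  refine ⟨h.nonempty, ?_⟩
  obtain ⟨p, S, hS, rfl⟩ := h
  refine ⟨AffineSubspace.mk' p S, ?_⟩
  ext x
  simp [AffineSubspace.mem_mk']

theorem IsFlat.finrank_vectorSpan {d : ℕ} {A : Set V} (h : IsFlat K d A) :
    finrank K (vectorSpan K A) = d := by
  obtain ⟨p, S, hS, rfl⟩ := h
  have : {x | x - p ∈ S} = (AffineSubspace.mk' p S : Set V) := by
    ext x
    simp [AffineSubspace.mem_mk']
  rw [this, ← AffineSubspace.direction_eq_vectorSpan, AffineSubspace.direction_mk', hS]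

theorem isFlat_of_affineSubspace {A : Set V}
    (h : A.Nonempty ∧ ∃ S : AffineSubspace K V, (S : Set V) = A) :
    IsFlat K (finrank K (vectorSpan K A)) A := by
  obtain ⟨⟨p, hp⟩, S, rfl⟩ := h
  refine ⟨p, S.direction, by rw [AffineSubspace.direction_eq_vectorSpan], ?_⟩
  ext x
  exact (AffineSubspace.vsub_right_mem_direction_iff_mem hp x).symm

end AffineSubspaces

/-! ### Matrices that are central up to a scalar -/

section CentralMatrix

variable {k : Type*} [DivisionRing k]

theorem mem_center_iff_forall_mul {z : k} : z ∈ Subring.center k ↔ ∀ c, c * z = z * c :=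
  Subring.mem_center_iff

/-- A matrix whose rows satisfy the relations below is a scalar multiple of a central one. -/
theorem exists_mul_mem_center {n : ℕ} (hn : 2 ≤ n) (M : Fin n → Fin n → k)
    (hcol : ∀ l, ∃ i, M i l ≠ 0)
    (hM : ∀ i j, i ≠ j → ∀ μ, μ ∉ Subring.center k → ∀ c : k, ∃ c' : k, ∀ l,
      c * M i l + μ * c * M j l = (M i l + μ * M j l) * c') :
    ∃ a : k, a ≠ 0 ∧ ∀ i j, a⁻¹ * M i j ∈ Subring.center k := by
  have hquot : ∀ i j l, M j l ≠ 0 → M i l * (M j l)⁻¹ ∈ Subring.center k := by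
    intro i j l hj
    by_contra hcon
    have hij : i ≠ j := by
      rintro rfl
      rw [mul_inv_cancel₀ hj] at hcon
      exact hcon (one_mem _)
    -- This `μ` annihilates the combination in column `l`, so the relation says that the ratio
    -- commutes with every `c`.
    have hμ : -(M i l * (M j l)⁻¹) ∉ Subring.center k := by
      rwa [neg_mem_iff]
    refine hcon (mem_center_iff_forall_mul.2 fun c => ?_)
    obtain ⟨c', hc'⟩ := hM i j hij _ hμ c
    have h := hc' l
    simp only [neg_mul] at h
    rw [inv_mul_cancel_right₀ hj, add_neg_cancel, zero_mul, add_neg_eq_zero] at h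
    rw [← mul_assoc, h, mul_inv_cancel_right₀ hj]
  choose r hr using hcol
  obtain ⟨l₀⟩ : Nonempty (Fin n) := ⟨⟨0, by omega⟩⟩
  refine ⟨M (r l₀) l₀, hr l₀, fun i m => ?_⟩
  -- In each column the relation expresses `c'` as the conjugate of `c` by the leading entry. As
  -- `c'` is common to all columns, two leading entries induce the same conjugation, so their ratio
  -- is central.
  have hratio : M (r m) m * (M (r l₀) l₀)⁻¹ ∈ Subring.center k := by
    by_cases hcomm : ∃ μ : k, μ ∉ Subring.center k
    swap
    · push Not at hcomm
      exact hcomm _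
    obtain ⟨μ, hμ⟩ := hcomm
    have hij : ∃ i j, i ≠ j ∧ (∃ i' ∈ ({i, j} : Set (Fin n)), M i' l₀ ≠ 0) ∧
        ∃ i' ∈ ({i, j} : Set (Fin n)), M i' m ≠ 0 := by
      by_cases h : r l₀ = r m
      · have : Nontrivial (Fin n) := Fin.nontrivial_iff_two_le.2 hn
        obtain ⟨j, hj⟩ := exists_ne (r m)
        exact ⟨r m, j, hj.symm, ⟨r m, by simp, h ▸ hr l₀⟩, r m, by simp, hr m⟩
      · exact ⟨r l₀, r m, h, ⟨r l₀, by simp, hr l₀⟩, r m, by simp, hr m⟩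
    obtain ⟨i, j, hne, hl, hm⟩ := hij
    -- conjugation by the leading entry of a column
    have hconj : ∀ l, (∃ i' ∈ ({i, j} : Set (Fin n)), M i' l ≠ 0) → ∀ c c' : k,
        c * M i l + μ * c * M j l = (M i l + μ * M j l) * c' → c' = (M (r l) l)⁻¹ * c * M (r l) l := by
      intro l hl c c' hc
      have hz : ∀ i, ∃ z ∈ Subring.center k, M i l = z * M (r l) l := fun i =>
        ⟨_, hquot i (r l) l (hr l), by rw [inv_mul_cancel_right₀ (hr l)]⟩
      obtain ⟨w, hw, hjw⟩ := hz j
      obtain ⟨z, hz, hiz⟩ := hz i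
      have hzc := mem_center_iff_forall_mul.1 hz
      have hwc := mem_center_iff_forall_mul.1 hw
      -- Otherwise `μ` would be a quotient of central elements, or the column would vanish in both
      -- rows.
      have hs : z + μ * w ≠ 0 := by
        intro h0
        by_cases hw0 : w = 0
        · have hz0 : z = 0 := by simpa [hw0] using h0
          obtain ⟨i', hi', hne'⟩ := hl
          rcases hi' with rfl | rfl
          · exact hne' (by rw [hiz, hz0, zero_mul])
          · exact hne' (by rw [hjw, hw0, zero_mul])
        · apply hμ
          have : μ = -z * w⁻¹ := by
            rw [eq_mul_inv_iff_mul_eq₀ hw0]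
            exact eq_neg_of_add_eq_zero_right h0
          rw [this]
          exact mul_mem (neg_mem hz) (Set.inv_mem_center hw)
      rw [hiz, hjw] at hc
      have h1 : (z + μ * w) * (c * M (r l) l) = (z + μ * w) * (M (r l) l * c') := by
        calc (z + μ * w) * (c * M (r l) l)
            = z * c * M (r l) l + μ * (w * c) * M (r l) l := by noncomm_ring
          _ = c * (z * M (r l) l) + μ * c * (w * M (r l) l) := by
              rw [← hzc, ← hwc]
              noncomm_ring
          _ = (z + μ * w) * (M (r l) l * c') := by
              rw [hc]
              noncomm_ring
      have h2 := mul_left_cancel₀ hs h1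
      rw [mul_assoc, h2, inv_mul_cancel_left₀ (hr l)]
    refine mem_center_iff_forall_mul.2 fun c => ?_
    obtain ⟨c', hc'⟩ := hM i j hne μ hμ c
    have h := (hconj m hm c c' (hc' m)).symm.trans (hconj l₀ hl c c' (hc' l₀))
    have h' : c * M (r m) m = M (r m) m * ((M (r l₀) l₀)⁻¹ * c * M (r l₀) l₀) := by
      rw [← h, mul_assoc, mul_inv_cancel_left₀ (hr m)]
    rw [← mul_assoc, h', mul_assoc, mul_assoc, mul_inv_cancel₀ (hr l₀), mul_one, ← mul_assoc]
  have h1 := mul_mem (hquot i (r m) m (hr m)) hratio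
  have h2 : M i m = M i m * (M (r m) m)⁻¹ * (M (r m) m * (M (r l₀) l₀)⁻¹) * M (r l₀) l₀ := by
    rw [← mul_assoc, inv_mul_cancel_right₀ (hr m), inv_mul_cancel_right₀ (hr l₀)]
  rw [h2, ← mem_center_iff_forall_mul.1 h1, inv_mul_cancel_left₀ (hr l₀)]
  exact h1

end CentralMatrix

/-! ### Semiaffine maps in standard form -/

section StandardForm

variable {k : Type*} [DivisionRing k]

theorem IsSemiaffine.hasStandardForm {n : ℕ} (hn : 2 ≤ n) {h : (Fin n → k) → (Fin n → k)}
    (hbij : Function.Bijective h) {σ : k ≃+* k} (hσ : IsSemiaffine σ h)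
    (hf : ∀ A : Set (Fin n → k), IsFlat kᵐᵒᵖ 1 A → IsMixedFlat k kᵐᵒᵖ 1 (h '' A)) :
    HasStandardForm h := by
  obtain ⟨hadd, hsmul⟩ := hσ
  let T : (Fin n → k) →ₗ[k] (Fin n → k) :=
    { toFun := fun x j => σ.symm (h x j - h 0 j)
      map_add' := fun x y => by
        funext j
        have := congrFun (hadd x y) j
        simp only [Pi.sub_apply, Pi.add_apply] at this ⊢
        rw [this, map_add]
      map_smul' := fun c x => by
        funext j
        have := congrFun (hsmul c x) j
        simp only [Pi.sub_apply, Pi.smul_apply, smul_eq_mul] at this ⊢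
        rw [this, map_mul]
        simp }
  have hT : ∀ x j, T x j = σ.symm (h x j - h 0 j) := fun _ _ => rfl
  have hTh : ∀ x j, h x j = σ (T x j) + h 0 j := fun x j => by
    rw [hT, RingEquiv.apply_symm_apply, sub_add_cancel]
  have hTadd : ∀ i j : Fin n, ∀ c d : k, ∀ l, T (Pi.single i c + Pi.single j d) l =
      c * T (Pi.single i 1) l + d * T (Pi.single j 1) l := by
    intro i j c d l
    have hs : ∀ (i : Fin n) (c : k), (Pi.single i c : Fin n → k) = c • Pi.single i 1 := fun i c => by
      rw [← Pi.single_smul', smul_eq_mul, mul_one]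
    rw [hs i c, hs j d, map_add, map_smul, map_smul]
    rfl
  have hcol : ∀ l, ∃ i, T (Pi.single i 1) l ≠ 0 := by
    intro l
    by_contra! h0
    obtain ⟨x, hx⟩ := hbij.2 (h 0 + Pi.single l 1)
    have h1 : T x l = 1 := by
      rw [hT, hx]
      simp
    rw [pi_eq_sum_univ x, map_sum, Finset.sum_apply] at h1
    have h2 : ∀ i, T (x i • fun j => if i = j then 1 else 0) l = 0 := by
      intro i
      have : (fun j => if i = j then (1 : k) else 0) = Pi.single i 1 := by
        funext j
        simp [Pi.single_apply, eq_comm]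
      rw [this, map_smul, Pi.smul_apply, h0, smul_zero]
    rw [Finset.sum_eq_zero fun i _ => h2 i] at h1
    exact zero_ne_one h1
  have hM : ∀ i j : Fin n, i ≠ j → ∀ μ, μ ∉ Subring.center k → ∀ c : k, ∃ c' : k, ∀ l,
      c * T (Pi.single i 1) l + μ * c * T (Pi.single j 1) l =
        (T (Pi.single i 1) l + μ * T (Pi.single j 1) l) * c' := by
    intro i j hij μ hμ c
    set v : Fin n → k := Pi.single i 1 + Pi.single j μ with hv
    have hvi : v i = 1 := by simp [hv, hij]
    have hvj : v j = μ := by simp [hv, hij.symm]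
    have hv0 : v ≠ 0 := fun h0 => one_ne_zero (hvi.symm.trans (congrFun h0 i))
    have hop : ∀ c : k, MulOpposite.op c • v = Pi.single i c + Pi.single j (μ * c) := by
      intro c
      funext l
      simp only [hv, Pi.smul_apply, Pi.add_apply, MulOpposite.smul_eq_mul_unop,
        MulOpposite.unop_op, add_mul]
      congr 1 <;> simp [Pi.single_apply]
    rcases hf _ ⟨0, _, finrank_span_singleton hv0, rfl⟩ with hA | hA
    -- If the image is a left line, the right line spanned by `v` contains every `c • v`. Comparing
    -- the entries 1 and `μ` then makes `μ` central.
    · exfalso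
      obtain ⟨S, hS, hSA⟩ := hA.exists_direction
      have h0 : h 0 ∈ h '' {x | x - 0 ∈ Submodule.span kᵐᵒᵖ {v}} := ⟨0, by simp, rfl⟩
      have hvA : h v ∈ h '' {x | x - 0 ∈ Submodule.span kᵐᵒᵖ {v}} :=
        ⟨v, by simp, rfl⟩
      refine hμ (mem_center_iff_forall_mul.2 fun c => ?_)
      have hc : h (c • v) ∈ h '' {x | x - 0 ∈ Submodule.span kᵐᵒᵖ {v}} := by
        rw [hSA _ h0] at hvA ⊢
        show h (c • v) - h 0 ∈ S
        rw [hsmul]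
        exact S.smul_mem _ hvA
      rw [hbij.1.mem_set_image] at hc
      obtain ⟨t, ht⟩ := Submodule.mem_span_singleton.1 hc
      rw [sub_zero] at ht
      have h1 := congrFun ht i
      have h2 := congrFun ht j
      simp only [Pi.smul_apply, MulOpposite.smul_eq_mul_unop, smul_eq_mul, hvi, hvj, one_mul,
        mul_one] at h1 h2
      rw [← h2, h1]
    · obtain ⟨d, hd⟩ := (exists_smul_sub_of_isFlat hbij.1 hv0 hA).1 (MulOpposite.op c)
      refine ⟨σ.symm d.unop, fun l => ?_⟩
      have := congrArg σ.symm (congrFun hd l)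
      simp only [zero_add, Pi.sub_apply, Pi.smul_apply, MulOpposite.smul_eq_mul_unop,
        map_mul] at this
      rw [← hT, ← hT, hop, hTadd, hv, hTadd, one_mul] at this
      exact this
  obtain ⟨a, ha, hcen⟩ := exists_mul_mem_center hn (fun i => T (Pi.single i 1)) hcol hM
  -- Right multiplication by `a⁻¹` is left linear and undoes `x ↦ xa`; on basis vectors it is also
  -- left multiplication by `a⁻¹`, so the matrix of `T.comp R` is central.
  let R : (Fin n → k) →ₗ[k] (Fin n → k) :=
    { toFun := fun x i => x i * a⁻¹
      map_add' := fun x y => funext fun i => add_mul _ _ _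
      map_smul' := fun c x => funext fun i => mul_assoc _ _ _ }
  refine ⟨a, fun j => σ.symm (h 0 j), σ, T.comp R, fun i j => ?_, fun x j => ?_⟩
  · have : R (Pi.single i 1) = a⁻¹ • Pi.single i 1 := by
      funext j
      by_cases hij : j = i
      · subst hij
        simp [R]
      · simp [R, hij]
    rw [LinearMap.comp_apply, this, map_smul]
    exact hcen i j
  · have : R (fun i => x i * a) = x := funext fun i => mul_inv_cancel_right₀ ha (x i)
    rw [LinearMap.comp_apply, this, map_add, RingEquiv.apply_symm_apply, hTh]

end StandardForm

/-! ### Purely left directions in the plane -/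

section GenericDirections

/-- A group is not the union of two proper subgroups; this lets one scalar avoid two commutation
conditions at once. -/
theorem exists_notMem_notMem {A : Type*} [AddGroup A] {H H' : AddSubgroup A} {x y : A}
    (hx : x ∉ H) (hy : y ∉ H') : ∃ z, z ∉ H ∧ z ∉ H' := by
  by_cases hx' : x ∈ H'
  · by_cases hy' : y ∈ H
    · exact ⟨x + y, fun h => hx ((H.add_mem_cancel_right hy').1 h),
        fun h => hy ((H'.add_mem_cancel_left hx').1 h)⟩
    · exact ⟨y, hy', hy⟩
  · exact ⟨x, hx, hx'⟩

variable {k : Type*} [DivisionRing k]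

/-- The elements `t` such that `a t` commutes with `c`. -/
def commutingMul (a c : k) : AddSubgroup k where
  carrier := {t | Commute (a * t) c}
  add_mem' := fun h h' => by
    simp only [Set.mem_ofPred_eq, mul_add] at *
    exact h.add_left h'
  zero_mem' := by simp
  neg_mem' := fun h => by simpa using h

theorem mem_commutingMul {a c t : k} : t ∈ commutingMul a c ↔ Commute (a * t) c := Iff.rfl

theorem exists_not_commute {c : k} (hc : c ∉ Subring.center k) : ∃ b, ¬ Commute b c := by
  by_contra! h
  exact hc (mem_center_iff_forall_mul.2 h)

theorem Commute.of_mem_center {z c : k} (hz : z ∈ Subring.center k) : Commute z c :=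
  (mem_center_iff_forall_mul.1 hz c).symm

theorem notMem_center_of_not_commute {b c : k} (h : ¬ Commute b c) : b ∉ Subring.center k :=
  fun hb => h (Commute.of_mem_center hb)

/-- The vectors of `k²` that span a purely left line. -/
def genericVectors (k : Type*) [DivisionRing k] : Set (Fin 2 → k) :=
  {v | ∃ s c : k, s ≠ 0 ∧ c ∉ Subring.center k ∧ v = ![s, s * c]}

theorem mem_genericVectors {s c : k} (hs : s ≠ 0) (hc : c ∉ Subring.center k) :
    ![s, s * c] ∈ genericVectors k :=
  ⟨s, c, hs, hc, rfl⟩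

theorem genericVectors_ne_zero {v : Fin 2 → k} (hv : v ∈ genericVectors k) : v ≠ 0 := by
  obtain ⟨s, c, hs, -, rfl⟩ := hv
  exact fun h => hs (congrFun h 0)

theorem notMem_span_generic {s t c d : k} (ht : t ≠ 0) (hcd : c ≠ d) :
    ![t, t * d] ∉ Submodule.span k {![s, s * c]} := by
  intro h
  obtain ⟨r, hr⟩ := Submodule.mem_span_singleton.1 h
  have h0 : r * s = t := congrFun hr 0
  have h1 : r * (s * c) = t * d := congrFun hr 1
  rw [← mul_assoc, h0] at h1
  exact hcd (mul_left_cancel₀ ht h1)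

theorem closure_genericVectors {y : Fin 2 → k} (hy : y ∈ genericVectors k) :
    AddSubgroup.closure (genericVectors k \ Submodule.span k {y}) = ⊤ := by
  obtain ⟨t, d, ht, hd, rfl⟩ := hy
  obtain ⟨c, hc⟩ := exists_not_commute hd
  have hc' : ¬ Commute (c + 1) d := fun h => hc (by simpa using h.sub_left (Commute.one_left d))
  -- Failure to commute with `d` ensures both that the slope is not central and that it differs from
  -- `d`. The slopes `c` and `c + 1` both qualify, and their difference yields the vectors `(0, s)`.
  have hmem : ∀ s c : k, ¬ Commute c d → ![s, s * c] ∈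
      AddSubgroup.closure (genericVectors k \ Submodule.span k {![t, t * d]}) := by
    intro s c hc
    by_cases hs : s = 0
    · have : ![s, s * c] = 0 := by
        ext i
        fin_cases i <;> simp [hs]
      rw [this]
      exact zero_mem _
    · refine AddSubgroup.subset_closure
        ⟨mem_genericVectors hs (notMem_center_of_not_commute hc), notMem_span_generic hs ?_⟩
      rintro rfl
      exact hc (Commute.refl _)
  have h1 : ∀ s : k, ![0, s] ∈
      AddSubgroup.closure (genericVectors k \ Submodule.span k {![t, t * d]}) := by
    intro s
    have := sub_mem (hmem s (c + 1) hc') (hmem s c hc)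
    convert this using 1
    ext i
    fin_cases i <;> simp [mul_add]
  rw [eq_top_iff]
  intro v _
  have := add_mem (hmem (v 0) c hc) (h1 (v 1 - v 0 * c))
  convert this using 1
  ext i
  fin_cases i <;> simp

theorem connected_genericVectors {R : (Fin 2 → k) → (Fin 2 → k) → Prop} (hR : Equivalence R)
    (h : ∀ x ∈ genericVectors k, ∀ y ∈ genericVectors k, y ∉ Submodule.span k {x} →
      x + y ∈ genericVectors k → R x y) :
    ∀ x ∈ genericVectors k, ∀ y ∈ genericVectors k, R x y := by
  have hadd : ∀ {u d : k}, u ≠ 0 → d ∉ Subring.center k → ∀ {x y : Fin 2 → k},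
      x 0 + y 0 = u → x 1 + y 1 = u * d → x + y ∈ genericVectors k := by
    intro u d hu hd x y h0 h1
    refine ⟨u, d, hu, hd, ?_⟩
    ext i
    fin_cases i
    · exact h0
    · exact h1
  -- The sum has slope `c + (s + t)⁻¹ t`; were it central, `s⁻¹ t` would commute with `c`.
  have hA : ∀ {c s t : k}, c ∉ Subring.center k → s ≠ 0 → ¬ Commute (s⁻¹ * t) c →
      R ![s, s * c] ![t, t * (c + 1)] := by
    intro c s t hc hs hst
    have ht : t ≠ 0 := by
      rintro rfl
      simp at hst
    have hc1 : c + 1 ∉ Subring.center k := fun h => hc (by simpa using sub_mem h (one_mem _))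
    have hu : s + t ≠ 0 := by
      intro h0
      rw [eq_neg_of_add_eq_zero_right h0, mul_neg, inv_mul_cancel₀ hs] at hst
      exact hst (Commute.one_left c).neg_left
    refine h _ (mem_genericVectors hs hc) _ (mem_genericVectors ht hc1)
      (notMem_span_generic ht (by simp)) (hadd hu (d := c + (s + t)⁻¹ * t) ?_ ?_ ?_)
    · intro hcen
      apply hst
      have h1 : Commute ((s + t)⁻¹ * t) c := by
        have := (Commute.of_mem_center hcen (c := c)).sub_left (Commute.refl c)
        rwa [add_sub_cancel_left] at this
      have h2 := h1.inv_left₀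
      rw [mul_inv_rev, inv_inv, mul_add, inv_mul_cancel₀ ht] at h2
      have h3 := (h2.sub_left (Commute.one_left c)).inv_left₀
      rwa [add_sub_cancel_right, mul_inv_rev, inv_inv] at h3
    · rfl
    · show s * c + t * (c + 1) = _
      rw [mul_add (s + t), mul_inv_cancel_left₀ hu]
      noncomm_ring
  -- Same slope, different scale: both vectors are linked to one vector of slope `c + 1`.
  have hB : ∀ {c s s' : k}, c ∉ Subring.center k → s ≠ 0 → s' ≠ 0 →
      R ![s, s * c] ![s', s' * c] := by
    intro c s s' hc hs hs'
    obtain ⟨b, hb⟩ := exists_not_commute hc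
    have hmem : ∀ {s : k}, s ≠ 0 → s * b ∉ commutingMul s⁻¹ c := fun hs h => by
      rw [mem_commutingMul, inv_mul_cancel_left₀ hs] at h
      exact hb h
    obtain ⟨t, ht, ht'⟩ := exists_notMem_notMem (hmem hs) (hmem hs')
    exact hR.trans (hA hc hs ht) (hR.symm (hA hc hs' ht'))
  -- Rescaling to first entries `c - 1` and `1` gives a sum with first entry `c` and slope `c - 1 +
  -- c⁻¹ d`, which is central only if `c` and `d` commute.
  have hC : ∀ {c d s t : k}, s ≠ 0 → t ≠ 0 → ¬ Commute c d → R ![s, s * c] ![t, t * d] := by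
    intro c d s t hs ht hcd
    have hc := notMem_center_of_not_commute hcd
    have hd : d ∉ Subring.center k := notMem_center_of_not_commute fun h => hcd h.symm
    have hc0 : c ≠ 0 := by
      rintro rfl
      exact hc (zero_mem _)
    have hc1 : c - 1 ≠ 0 := by
      intro h0
      rw [sub_eq_zero] at h0
      exact hc (h0 ▸ one_mem _)
    refine hR.trans (hB hc hs hc1) (hR.trans (h _ (mem_genericVectors hc1 hc) _
      (mem_genericVectors one_ne_zero hd) (notMem_span_generic one_ne_zero ?_)
      (hadd hc0 (d := c - 1 + c⁻¹ * d) ?_ ?_ ?_)) (hB hd one_ne_zero ht))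
    · rintro rfl
      exact hcd (Commute.refl _)
    · intro hcen
      apply hcd
      have h1 : Commute (c⁻¹ * d) c := by
        have := (Commute.of_mem_center hcen (c := c)).sub_left
          ((Commute.refl c).sub_left (Commute.one_left c))
        rwa [add_sub_cancel_left] at this
      have h2 := (Commute.refl c).mul_left h1
      rw [mul_inv_cancel_left₀ hc0] at h2
      exact h2.symm
    · simp
    · show (c - 1) * c + 1 * d = _
      rw [mul_add, mul_inv_cancel_left₀ hc0]
      noncomm_ring
  rintro _ ⟨s, c, hs, hc, rfl⟩ _ ⟨t, d, ht, hd, rfl⟩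
  obtain ⟨b, hb⟩ := exists_not_commute hc
  obtain ⟨b', hb'⟩ := exists_not_commute hd
  -- A slope `e` commuting with neither `c` nor `d` links the two.
  obtain ⟨e, he, he'⟩ := exists_notMem_notMem (H := commutingMul 1 c) (H' := commutingMul 1 d)
    (x := b) (y := b') (by rwa [mem_commutingMul, one_mul]) (by rwa [mem_commutingMul, one_mul])
  rw [mem_commutingMul, one_mul] at he he'
  exact hR.trans (hR.symm (hC one_ne_zero hs he)) (hC one_ne_zero ht he')

/-- The affine line through `p` spanned by a generic vector is not a right affine subspace. -/
theorem not_isFlat_of_mem_genericVectors {x : Fin 2 → k} (hx : x ∈ genericVectors k)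
    (p : Fin 2 → k) (d : ℕ) : ¬ IsFlat kᵐᵒᵖ d {z | z - p ∈ Submodule.span k {x}} := by
  intro hflat
  obtain ⟨S, -, hS⟩ := hflat.exists_direction
  obtain ⟨s, c, hs, hc, rfl⟩ := hx
  have hp := hS p (by simp)
  refine hc (mem_center_iff_forall_mul.2 fun t => ?_)
  have hmem : ∀ v : Fin 2 → k, v ∈ Submodule.span k {![s, s * c]} ↔ v ∈ S := fun v => by
    have := Set.ext_iff.1 hp (v + p)
    simpa using this
  have h1 := (hmem (MulOpposite.op t • ![s, s * c])).2
    (S.smul_mem _ ((hmem _).1 (Submodule.mem_span_singleton_self _)))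
  obtain ⟨r, hr⟩ := Submodule.mem_span_singleton.1 h1
  have h0 : r * s = s * t := congrFun hr 0
  have h1 : r * (s * c) = s * c * t := congrFun hr 1
  rw [← mul_assoc, h0, mul_assoc, mul_assoc] at h1
  exact mul_left_cancel₀ hs h1

end GenericDirections

/-! ### Application to coordinate space, anti-automorphisms, and the three claims -/

section CoordinateSpace

variable {k : Type*} [DivisionRing k] {n : ℕ}

theorem isLeftAffine_iff {A : Set (Fin n → k)} : IsLeftAffine A ↔ IsFlat k (leftDim A) A :=
  ⟨isFlat_of_affineSubspace, IsFlat.exists_affineSubspace⟩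

theorem isRightAffine_iff {A : Set (Fin n → k)} : IsRightAffine A ↔ IsFlat kᵐᵒᵖ (rightDim A) A :=
  ⟨isFlat_of_affineSubspace, IsFlat.exists_affineSubspace⟩

theorem IsFlat.isLeftAffine {d : ℕ} {A : Set (Fin n → k)} (h : IsFlat k d A) : IsLeftAffine A :=
  h.exists_affineSubspace

theorem IsFlat.isRightAffine {d : ℕ} {A : Set (Fin n → k)} (h : IsFlat kᵐᵒᵖ d A) :
    IsRightAffine A :=
  h.exists_affineSubspace

theorem IsFlat.leftDim_eq {d : ℕ} {A : Set (Fin n → k)} (h : IsFlat k d A) : leftDim A = d :=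
  h.finrank_vectorSpan

/-- The map sends left and right affine subspaces to left or right affine subspaces. -/
def MapsAffine (f : (Fin n → k) → (Fin n → k)) : Prop :=
  ∀ A : Set (Fin n → k), IsLeftAffine A ∨ IsRightAffine A →
    IsLeftAffine (f '' A) ∨ IsRightAffine (f '' A)

theorem MapsAffine.exists_isMixedFlat {f : (Fin n → k) → (Fin n → k)} (hf : MapsAffine f) {d : ℕ}
    {A : Set (Fin n → k)} (hA : IsMixedFlat k kᵐᵒᵖ d A) :
    ∃ e, IsMixedFlat k kᵐᵒᵖ e (f '' A) := by
  rcases hf A (hA.imp IsFlat.isLeftAffine IsFlat.isRightAffine) with h | h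
  · exact ⟨_, Or.inl (isLeftAffine_iff.1 h)⟩
  · exact ⟨_, Or.inr (isRightAffine_iff.1 h)⟩

theorem MapsAffine.surjective {f : (Fin n → k) → (Fin n → k)} (hf : MapsAffine f)
    (hinj : Function.Injective f) : Function.Surjective f :=
  surjective_of_image_flat (K := k) (L := k) (L' := kᵐᵒᵖ) (dimAgree_mulOpposite n) rfl hinj
    fun _ _ hA => hf.exists_isMixedFlat (Or.inl hA)

theorem MapsAffine.dim_eq {f : (Fin n → k) → (Fin n → k)} (hf : MapsAffine f)
    (hinj : Function.Injective f) {d e : ℕ} {A : Set (Fin n → k)} (hA : IsMixedFlat k kᵐᵒᵖ d A)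
    (he : IsMixedFlat k kᵐᵒᵖ e (f '' A)) : e = d := by
  rcases hA with hA | hA
  · exact dim_image_eq (dimAgree_mulOpposite n) rfl hinj
      (fun _ _ hA => hf.exists_isMixedFlat (Or.inl hA)) hA he
  · exact dim_image_eq (K := kᵐᵒᵖ) (dimAgree_mulOpposite n)
      (by rw [finrank_mulOpposite_fun, finrank_fin_fun]) hinj
      (fun _ _ hA => hf.exists_isMixedFlat (Or.inr hA)) hA he

theorem MapsAffine.isMixedFlat {f : (Fin n → k) → (Fin n → k)} (hf : MapsAffine f)
    (hinj : Function.Injective f) {d : ℕ} {A : Set (Fin n → k)} (hA : IsMixedFlat k kᵐᵒᵖ d A) :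
    IsMixedFlat k kᵐᵒᵖ d (f '' A) := by
  obtain ⟨e, he⟩ := hf.exists_isMixedFlat hA
  exact hf.dim_eq hinj hA he ▸ he

theorem IsSemiaffine.preservesLeftAffine {h : (Fin n → k) → (Fin n → k)} {σ : k ≃+* k}
    (hσ : IsSemiaffine σ h) (hinj : Function.Injective h) (hf : MapsAffine h) :
    PreservesLeftAffine h := by
  intro A hA
  rw [isLeftAffine_iff] at hA
  obtain ⟨e, he⟩ := hσ.exists_isFlat_image hA
  exact ⟨he.isLeftAffine, he.leftDim_eq.trans (hf.dim_eq hinj (Or.inl hA) (Or.inl he))⟩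

theorem IsSemiaffine.preserves_and_hasStandardForm (hn : 2 ≤ n) {h : (Fin n → k) → (Fin n → k)}
    {σ : k ≃+* k} (hσ : IsSemiaffine σ h) (hinj : Function.Injective h) (hf : MapsAffine h) :
    PreservesLeftAffine h ∧ HasStandardForm h :=
  ⟨hσ.preservesLeftAffine hinj hf, hσ.hasStandardForm hn ⟨hinj, hf.surjective hinj⟩
    fun _ hA => hf.isMixedFlat hinj (Or.inr hA)⟩

/-- An anti-automorphism applied coordinatewise. -/
def antiMap (n : ℕ) (ε : k ≃+* kᵐᵒᵖ) (x : Fin n → k) : Fin n → k := fun i => (ε (x i)).unop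

theorem antiMap_zero (ε : k ≃+* kᵐᵒᵖ) : antiMap n ε 0 = 0 := by
  funext i
  simp [antiMap]

theorem antiMap_injective (ε : k ≃+* kᵐᵒᵖ) : Function.Injective (antiMap n ε) := fun _ _ h =>
  funext fun i => ε.injective (MulOpposite.unop_injective (congrFun h i))

theorem antiMap_add (ε : k ≃+* kᵐᵒᵖ) (x y : Fin n → k) :
    antiMap n ε (x + y) = antiMap n ε x + antiMap n ε y := by
  funext i
  simp [antiMap]

theorem isSemiaffine_antiMap_left (ε : k ≃+* kᵐᵒᵖ) : IsSemiaffine ε (antiMap n ε) := by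
  refine ⟨fun x y => by simp [antiMap_zero, antiMap_add], fun c x => ?_⟩
  funext i
  simp [antiMap]

/-- The isomorphism from the opposite ring induced by an anti-automorphism. -/
def antiSymm (ε : k ≃+* kᵐᵒᵖ) : kᵐᵒᵖ ≃+* k := (RingEquiv.op ε).trans (RingEquiv.opOp k).symm

theorem antiSymm_apply (ε : k ≃+* kᵐᵒᵖ) (c : kᵐᵒᵖ) : antiSymm ε c = (ε c.unop).unop := rfl

theorem isSemiaffine_antiMap_right (ε : k ≃+* kᵐᵒᵖ) :
    IsSemiaffine (antiSymm ε) (antiMap n ε) := by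
  refine ⟨fun x y => by simp [antiMap_zero, antiMap_add], fun c x => ?_⟩
  funext i
  simp [antiMap, antiSymm_apply]

/-- An anti-automorphism applied coordinatewise interchanges left and right flats. -/
theorem MapsAffine.antiMap_comp {f : (Fin n → k) → (Fin n → k)} (hf : MapsAffine f)
    (ε : k ≃+* kᵐᵒᵖ) : MapsAffine (antiMap n ε ∘ f) := by
  intro A hA
  rw [Set.image_comp]
  rcases hf A hA with h | h
  · obtain ⟨e, he⟩ := (isSemiaffine_antiMap_left ε).exists_isFlat_image (isLeftAffine_iff.1 h)
    exact Or.inr he.isRightAffine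
  · obtain ⟨e, he⟩ := (isSemiaffine_antiMap_right ε).exists_isFlat_image (isRightAffine_iff.1 h)
    exact Or.inl he.isLeftAffine

theorem IsFlat.mulOpposite_of_comm (hcomm : ∀ c : k, c ∈ Subring.center k) {d : ℕ}
    {A : Set (Fin n → k)} (hA : IsFlat k d A) : IsFlat kᵐᵒᵖ d A := by
  obtain ⟨p, S, hS, rfl⟩ := hA
  let S' : Submodule kᵐᵒᵖ (Fin n → k) :=
    { S.toAddSubmonoid with
      smul_mem' := fun c x hx => by
        have : c • x = c.unop • x := funext fun i => mem_center_iff_forall_mul.1 (hcomm c.unop) (x i)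
        rw [this]
        exact S.smul_mem _ hx }
  exact ⟨p, S', by rw [← hS, dimAgree_mulOpposite n S S' rfl], rfl⟩

/-- A two-sided plane over a noncommutative division ring contains a purely left line. -/
theorem exists_purelyLeft_line {c : k} (hc : c ∉ Subring.center k) {P : Set (Fin n → k)}
    (hP : IsFlat k 2 P) {e : ℕ} (hP' : IsFlat kᵐᵒᵖ e P) :
    ∃ L ⊆ P, IsFlat k 1 L ∧ ∀ d, ¬ IsFlat kᵐᵒᵖ d L := by
  obtain ⟨p, hp⟩ := hP.nonempty
  obtain ⟨S, hS, hSP⟩ := hP.exists_direction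
  obtain ⟨S', -, hSP'⟩ := hP'.exists_direction
  have hmem : ∀ v, v ∈ S ↔ v ∈ S' := fun v => by
    have := Set.ext_iff.1 ((hSP p hp).symm.trans (hSP' p hp)) (v + p)
    simpa using this
  by_contra! hcon
  -- If no line in `P` is purely left, right multiplication by `c` acts on each vector of `S` as
  -- some left scalar.
  have hstable : ∀ v ∈ S, ∀ c : k, ∃ a : k, a • v = MulOpposite.op c • v := by
    intro v hv c
    by_cases hv0 : v = 0
    · exact ⟨0, by simp [hv0]⟩
    obtain ⟨d, hd⟩ := hcon {x | x - p ∈ Submodule.span k {v}}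
      (by
        rw [hSP p hp]
        exact fun x hx => (Submodule.span_singleton_le_iff_mem v S).2 hv hx)
      ⟨p, _, finrank_span_singleton hv0, rfl⟩
    obtain ⟨T, -, hT⟩ := hd.exists_direction
    have hT' : ∀ w, w ∈ Submodule.span k {v} ↔ w ∈ T := fun w => by
      have := Set.ext_iff.1 (hT p (by simp)) (w + p)
      simpa using this
    exact Submodule.mem_span_singleton.1
      ((hT' _).2 (T.smul_mem _ ((hT' v).1 (Submodule.mem_span_singleton_self v))))
  obtain ⟨v, hv, hv0⟩ : ∃ v ∈ S, v ≠ 0 := Submodule.exists_mem_ne_zero_of_ne_bot (by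
    rintro rfl
    simp at hS)
  obtain ⟨w, hw, hwv⟩ : ∃ w ∈ S, w ∉ Submodule.span k {v} := by
    by_contra! h
    have := Submodule.finrank_mono (R := k) (s := S) (t := Submodule.span k {v}) h
    rw [hS, finrank_span_singleton hv0] at this
    omega
  have huniq : ∀ {a b : k}, a • v = b • w → a = 0 ∧ b = 0 := by
    intro a b hab
    have hb : b = 0 := by
      by_contra hb
      refine hwv (Submodule.mem_span_singleton.2 ⟨b⁻¹ * a, ?_⟩)
      rw [mul_smul, hab, smul_smul, inv_mul_cancel₀ hb, one_smul]
    rw [hb, zero_smul] at hab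
    exact ⟨(smul_eq_zero.1 hab).resolve_right hv0, hb⟩
  obtain ⟨a, ha⟩ := hstable v hv c
  obtain ⟨b, hb⟩ := hstable w hw c
  -- Comparing the scalars on `v`, `w` and `v + t w`; the case `t = 1` gives `a = b`, so `a` is
  -- central, and then `c = a`.
  have key : ∀ t : k, a * t = t * b := by
    intro t
    obtain ⟨e, he⟩ := hstable (v + t • w) (S.add_mem hv (S.smul_mem t hw)) c
    rw [smul_add, smul_add, smul_comm (MulOpposite.op c) t w, ← ha, ← hb, smul_smul, smul_smul] at he
    have h1 : (e - a) • v = (t * b - e * t) • w := by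
      rw [sub_smul, sub_smul, sub_eq_sub_iff_add_eq_add, he, add_comm]
    obtain ⟨h2, h3⟩ := huniq h1
    rw [sub_eq_zero] at h2 h3
    rw [← h2, h3]
  have hab : a = b := by simpa using key 1
  obtain ⟨i, hi⟩ := Function.ne_iff.1 hv0
  have h1 : a * v i = v i * c := congrFun ha i
  rw [key, ← hab] at h1
  rw [← mul_left_cancel₀ hi h1] at hc
  refine hc (mem_center_iff_forall_mul.2 fun t => ?_)
  rw [key t, ← hab]

/-- A map of the plane that sends the purely left lines to right lines is semiaffine. -/
theorem exists_isSemiaffine_of_genericVectors {c : k} (hc : c ∉ Subring.center k)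
    {f : (Fin 2 → k) → (Fin 2 → k)} (hinj : Function.Injective f)
    (hf : ∀ L : Set (Fin 2 → k), IsFlat k 1 L → (∀ d, ¬ IsFlat kᵐᵒᵖ d L) →
      IsFlat kᵐᵒᵖ 1 (f '' L)) :
    ∃ σ : k ≃+* kᵐᵒᵖ, IsSemiaffine σ f := by
  refine exists_isSemiaffine (G := genericVectors k) hinj (fun _ => genericVectors_ne_zero)
    (fun x hx p => hf _ ⟨p, _, finrank_span_singleton (genericVectors_ne_zero hx), rfl⟩
      (not_isFlat_of_mem_genericVectors hx p)) ?_ ⟨_, mem_genericVectors one_ne_zero hc⟩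
    (fun _ => closure_genericVectors) fun _ => connected_genericVectors
  intro x _ y _ _ p
  -- In dimension two the coplanarity requirement is empty: the target is itself a right plane.
  refine ⟨Set.univ, ?_, Set.subset_univ _⟩
  have := isFlat_univ (K := kᵐᵒᵖ) (V := Fin 2 → k)
  rwa [finrank_mulOpposite_fun] at this

theorem IsPurelyLeftLine.isFlat {L : Set (Fin n → k)} (h : IsPurelyLeftLine L) :
    IsFlat k 1 L ∧ ∀ d, ¬ IsFlat kᵐᵒᵖ d L :=
  ⟨h.2.2 ▸ isLeftAffine_iff.1 h.1, fun _ hd => h.2.1 hd.isRightAffine⟩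

theorem isPurelyLeftLine_of_isFlat {L : Set (Fin n → k)} (h : IsFlat k 1 L)
    (h' : ∀ d, ¬ IsFlat kᵐᵒᵖ d L) : IsPurelyLeftLine L :=
  ⟨h.isLeftAffine, fun hr => h' _ (isRightAffine_iff.1 hr), h.leftDim_eq⟩

/-- The image of a purely left line is not two-sided. -/
theorem MapsAffine.not_isFlat_both {f : (Fin n → k) → (Fin n → k)} (hf : MapsAffine f)
    (hinj : Function.Injective f) {L : Set (Fin n → k)} (hL : IsFlat k 1 L)
    (hL' : ∀ d, ¬ IsFlat kᵐᵒᵖ d L) (h : IsFlat k 1 (f '' L)) : ¬ IsFlat kᵐᵒᵖ 1 (f '' L) := by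
  intro h'
  obtain ⟨x, hx⟩ := hL.nonempty
  obtain ⟨y, hy, hyx⟩ := hL.exists_ne x
  exact hL' 1 (isFlat_of_image_two_sided hinj
    (fun A hA => hf.isMixedFlat hinj (Or.inr hA)) hyx.symm hx hy h h')

/-- Over a commutative `k` there are no purely left lines, but all flats are right flats and the
classical theorem applies. Otherwise, for `n = 2` the plane is the whole space and generic
directions are used; for `n ≥ 3` one purely left line in `P` starts the dichotomy. -/
theorem MapsAffine.exists_isSemiaffine_mulOpposite (hn : 2 ≤ n) {f : (Fin n → k) → (Fin n → k)}
    (hf : MapsAffine f) (hinj : Function.Injective f) {P : Set (Fin n → k)}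
    (hP : IsTwoSidedPlane P)
    (h : ∀ L : Set (Fin n → k), IsPurelyLeftLine L → L ⊆ P → IsRightAffine (f '' L)) :
    ∃ σ : k ≃+* kᵐᵒᵖ, IsSemiaffine σ f := by
  obtain ⟨hPl, hPr, hPd⟩ := hP
  rw [isLeftAffine_iff, hPd] at hPl
  rw [isRightAffine_iff] at hPr
  by_cases hcomm : ∀ c : k, c ∈ Subring.center k
  · have himage : ∀ (d : ℕ) (A : Set (Fin n → k)), IsFlat k d A → IsFlat kᵐᵒᵖ d (f '' A) :=
      fun d A hA => (hf.isMixedFlat hinj (Or.inl hA)).elim (IsFlat.mulOpposite_of_comm hcomm) id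
    exact exists_isSemiaffine_of_lines (by rwa [finrank_fin_fun]) hinj (himage 1) (himage 2)
  push Not at hcomm
  obtain ⟨c, hc⟩ := hcomm
  have hright : ∀ L ⊆ P, IsFlat k 1 L → (∀ d, ¬ IsFlat kᵐᵒᵖ d L) → IsFlat kᵐᵒᵖ 1 (f '' L) := by
    intro L hLP hL hL'
    have h1 := isRightAffine_iff.1 (h L (isPurelyLeftLine_of_isFlat hL hL') hLP)
    exact hf.dim_eq hinj (Or.inl hL) (Or.inr h1) ▸ h1
  rcases hn.eq_or_lt with rfl | hn
  · have hPuniv : P = Set.univ :=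
      (hPl.mono isFlat_univ (Set.subset_univ _)).2 (by rw [finrank_fin_fun])
    subst hPuniv
    exact exists_isSemiaffine_of_genericVectors hc hinj fun L => hright L (Set.subset_univ _)
  · obtain ⟨L, hLP, hL, hL'⟩ := exists_purelyLeft_line hc hPl hPr
    have h1 := hright L hLP hL hL'
    have : SMulCommClass kᵐᵒᵖ k (Fin n → k) := SMulCommClass.symm _ _ _
    exact exists_isSemiaffine_of_exists (dimAgree_mulOpposite n).symm hinj
      (fun d A hA => (hf.isMixedFlat hinj (Or.inl hA)).symm) (by rwa [finrank_fin_fun]) hL h1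
      fun h2 => hf.not_isFlat_both hinj hL hL' h2 h1

theorem MapsAffine.exists_isSemiaffine (hn : 3 ≤ n) {f : (Fin n → k) → (Fin n → k)}
    (hf : MapsAffine f) (hinj : Function.Injective f) {L : Set (Fin n → k)}
    (hL : IsPurelyLeftLine L) (h : IsLeftAffine (f '' L)) :
    ∃ σ : k ≃+* k, IsSemiaffine σ f := by
  obtain ⟨hL, hL'⟩ := hL.isFlat
  have h1 := isLeftAffine_iff.1 h
  rw [hf.dim_eq hinj (Or.inl hL) (Or.inl h1)] at h1
  exact exists_isSemiaffine_of_exists (dimAgree_mulOpposite n) hinj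
    (fun d A hA => hf.isMixedFlat hinj (Or.inl hA)) (by rwa [finrank_fin_fun]) hL h1
    (hf.not_isFlat_both hinj hL hL' h1)

end CoordinateSpace

theorem theorem1 {k : Type*} [DivisionRing k] {n : ℕ} (f : (Fin n → k) → (Fin n → k))
    (hinj : Function.Injective f)
    (hf : ∀ A : Set (Fin n → k), IsLeftAffine A ∨ IsRightAffine A →
      IsLeftAffine (f '' A) ∨ IsRightAffine (f '' A)) :
    -- (1)
    (Function.Bijective f ∧
      ∀ A : Set (Fin n → k),
        (IsLeftAffine A →
          (IsLeftAffine (f '' A) → leftDim (f '' A) = leftDim A) ∧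
          (IsRightAffine (f '' A) → rightDim (f '' A) = leftDim A)) ∧
        (IsRightAffine A →
          (IsLeftAffine (f '' A) → leftDim (f '' A) = rightDim A) ∧
          (IsRightAffine (f '' A) → rightDim (f '' A) = rightDim A))) ∧
    -- (2) and (3)
    ∀ P : Set (Fin n → k), IsTwoSidedPlane P →
      (3 ≤ n →
        (∃ L : Set (Fin n → k), IsPurelyLeftLine L ∧ L ⊆ P ∧ IsLeftAffine (f '' L)) →
        PreservesLeftAffine f ∧ HasStandardForm f) ∧
      (2 ≤ n →
        (∀ L : Set (Fin n → k), IsPurelyLeftLine L → L ⊆ P → IsRightAffine (f '' L)) →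
        Nonempty (k ≃+* kᵐᵒᵖ) ∧
        ∀ ε : k ≃+* kᵐᵒᵖ,
          PreservesLeftAffine (fun x i => (ε (f x i)).unop) ∧
          HasStandardForm (fun x i => (ε (f x i)).unop)) := by
  have hf : MapsAffine f := hf
  refine ⟨⟨⟨hinj, hf.surjective hinj⟩, fun A => ⟨fun hA => ⟨fun h => ?_, fun h => ?_⟩,
    fun hA => ⟨fun h => ?_, fun h => ?_⟩⟩⟩, fun P hP => ⟨fun hn => ?_, fun hn hP' => ?_⟩⟩
  · exact hf.dim_eq hinj (Or.inl (isLeftAffine_iff.1 hA)) (Or.inl (isLeftAffine_iff.1 h))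
  · exact hf.dim_eq hinj (Or.inl (isLeftAffine_iff.1 hA)) (Or.inr (isRightAffine_iff.1 h))
  · exact hf.dim_eq hinj (Or.inr (isRightAffine_iff.1 hA)) (Or.inl (isLeftAffine_iff.1 h))
  · exact hf.dim_eq hinj (Or.inr (isRightAffine_iff.1 hA)) (Or.inr (isRightAffine_iff.1 h))
  · rintro ⟨L, hL, -, hfL⟩
    obtain ⟨σ, hσ⟩ := hf.exists_isSemiaffine hn hinj hL hfL
    exact hσ.preserves_and_hasStandardForm (by omega) hinj hf
  · obtain ⟨σ, hσ⟩ := hf.exists_isSemiaffine_mulOpposite hn hinj hP hP'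
    -- The isomorphism attached to `f` is already an anti-automorphism.
    refine ⟨⟨σ⟩, fun ε => ?_⟩
    exact ((isSemiaffine_antiMap_right ε).comp hσ
      (antiMap_zero ε)).preserves_and_hasStandardForm hn ((antiMap_injective ε).comp hinj)
      (hf.antiMap_comp ε)
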